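/- Fix a countably infinite set of variables and an unlimited supply of predicates of every finite arity. An \emph{instance} is a (possibly infinite) set of atoms $R(\bar v)$, where $R$ is a predicate and $\bar v$ a tuple of variables whose length is the arity of $R$; $V(I)$ is the set of variables of $I$. For instances $I,J$, write $I\models J$ if $J[\theta]\subseteq I$ for some mapping $\theta$ from variables to variables; for a set $\mathcal J$ of instances, write $I\models\mathcal J$ if $I\models J$ for some $J\in\mathcal J$. A \emph{tgd} is a rule $B\to H$ with $B,H$ finite instances; $I\models (B\to H)$ means that for every $\theta$ with $B[\theta]\subseteq I$ there is $\eta$ that agrees with $\theta$ on $V(B)\cap V(H)$ and satisfies $H[\eta]\subseteq I$. For an instance $D$, a set $\Sigma$ of tgds and a set $\mathcal Q$ of instances, $D\wedge\Sigma\models\mathcal Q$ means that every instance $M$ (finite or infinite) with $M\models D$ and $M\models r$ for all $r\in\Sigma$ satisfies $M\models\mathcal Q$. A tgd $B\to H$ is \emph{$\beta$-guarded} if there is an atom $G\in B$ with $V(B)\subseteq V(G)$. A \emph{Datalog rewriting} for $(\Sigma,\mathcal Q)$ is a triple $(\mathcal A,\Gamma,G)$ where $\mathcal A$ is a set of predicates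 that do not occur in $\Sigma$ or $\mathcal Q$; $\Gamma$ is a finite set of tgds $B\to H$ with $V(H)\subseteq V(B)$; $G=\{\mathsf G()\}$ for some $0$-ary predicate $\mathsf G\in\mathcal A$; and for every instance $D$ in which no predicate of $\mathcal A$ occurs, $$D\wedge\Sigma\models\mathcal Q\quad\text{iff}\quad D\wedge\Gamma\models\{G\}.$$ \textbf{Corollary 5.} There is an algorithm (a total computable function) that, given a finite set $\Sigma$ of $\beta$-guarded tgds and a finite set $\mathcal Q$ of finite instances, computes a Datalog rewriting $(\mathcal A,\Gamma,G)$ for $(\Sigma,\mathcal Q)$, with $\mathcal A$ finite. -/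

import Mathlib

namespace DatalogRew

/-- The countably infinite set of variables. -/
abbrev Var := ℕ

/-- A predicate, given by its name and its arity; two predicates are equal iff both name and
arity agree. -/
abbrev Pred := ℕ × ℕ

/-- An atom `R(v₁,…,vₙ)`, given by the name of `R` and the list `[v₁,…,vₙ]`. -/
abbrev Atom := ℕ × List Var

/-- The predicate of an atom. Its arity is the number of arguments, so every atom respects the
arity of its predicate. -/
def Atom.pred (a : Atom) : Pred := (a.1, a.2.length)

/-- An instance is a (possibly infinite) set of atoms. -/
abbrev Instance := Set Atom

/-- A finite instance, given by a list of its atoms. -/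
abbrev FinInstance := List Atom

/-- The instance listed by a finite instance. -/
def FinInstance.toInstance (I : FinInstance) : Instance := {a | a ∈ I}

/-- `V(I)`: the variables occurring in an instance. -/
def vars (I : Instance) : Set Var := {v | ∃ a ∈ I, v ∈ a.2}

/-- The predicates occurring in an instance. -/
def preds (I : Instance) : Set Pred := {p | ∃ a ∈ I, Atom.pred a = p}

/-- `a[θ]`: application of a renaming to an atom. -/
def Atom.rename (θ : Var → Var) (a : Atom) : Atom := (a.1, a.2.map θ)

/-- `I[θ]`: application of a renaming to an instance. -/
def rename (θ : Var → Var) (I : Instance) : Instance := Atom.rename θ '' I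

/-- `I ⊨ J` for two instances: `J[θ] ⊆ I` for some renaming `θ`. -/
def Entails (I J : Instance) : Prop := ∃ θ : Var → Var, rename θ J ⊆ I

/-- `I ⊨ 𝒥` for an instance and a set of instances (a disjunction). -/
def EntailsSome (I : Instance) (𝒥 : Set Instance) : Prop := ∃ J ∈ 𝒥, Entails I J

/-- A tgd `B → H`, given by its body and its head. -/
abbrev TGD := FinInstance × FinInstance

/-- The body of a tgd. -/
def TGD.body (r : TGD) : Instance := FinInstance.toInstance r.1

/-- The head of a tgd. -/
def TGD.head (r : TGD) : Instance := FinInstance.toInstance r.2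

/-- `I ⊨ r` for a tgd `r : B(X,Y) → H(X,Z)`: for every valuation `θ` of `X ∪ Y` that maps the body
into `I` there is a valuation `η` of `X ∪ Z` that agrees with `θ` on `X = V(B) ∩ V(H)` and maps the
head into `I`. -/
def Satisfies (I : Instance) (r : TGD) : Prop :=
  ∀ θ : Var → Var, rename θ (TGD.body r) ⊆ I →
    ∃ η : Var → Var, (∀ v ∈ vars (TGD.body r) ∩ vars (TGD.head r), η v = θ v) ∧
      rename η (TGD.head r) ⊆ I

/-- `𝒟 ∧ S ⊨ 𝒬`: the set of instances `𝒬` is certain in `𝒟` under the set `S` of tgds. -/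
def Certain (𝒟 : Set Instance) (S : Set TGD) (𝒬 : Set Instance) : Prop :=
  ∀ M : Instance, EntailsSome M 𝒟 → (∀ r ∈ S, Satisfies M r) → EntailsSome M 𝒬

/-- A tgd `B → H` is β-guarded iff some atom of `B` contains all the variables of `B`. -/
def BetaGuarded (r : TGD) : Prop := ∃ g ∈ TGD.body r, vars (TGD.body r) ⊆ {v | v ∈ g.2}

/-- A Datalog rule (full tgd) `B → H`: all the variables of `H` occur in `B`. -/
def IsDatalogRule (r : TGD) : Prop := vars (TGD.head r) ⊆ vars (TGD.body r)

/-- `(A, Γ, G)` is a Datalog rewriting for `(S, 𝒬)`. -/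
structure IsDatalogRewriting (S : Set TGD) (𝒬 : Set Instance)
    (A : Set Pred) (Γ : Set TGD) (G : Instance) : Prop where
  /-- The auxiliary predicates do not occur in `S`. -/
  fresh_tgds : ∀ r ∈ S, Disjoint A (preds (TGD.body r) ∪ preds (TGD.head r))
  /-- The auxiliary predicates do not occur in `𝒬`. -/
  fresh_query : ∀ Q ∈ 𝒬, Disjoint A (preds Q)
  /-- `Γ` is finite. -/
  finite : Γ.Finite
  /-- `Γ` consists of Datalog rules. -/
  datalog : ∀ r ∈ Γ, IsDatalogRule r
  /-- `G` consists of a single atom without arguments whose predicate is auxiliary. -/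
  goal : ∃ g : ℕ, ((g, 0) : Pred) ∈ A ∧ G = {((g, []) : Atom)}
  /-- On `A`-free instances, `Γ` and `G` have the same answer as `S` and `𝒬`. -/
  equiv : ∀ D : Instance, Disjoint A (preds D) → (Certain {D} S 𝒬 ↔ Certain {D} Γ {G})

end DatalogRew

/-! Existential rules can be removed once it is known which consequences a newly created part of a
model sends back to the part that created it. Let `w` bound the variables of the input. When a tgd
fires, the new bag consists of its head and of the known atoms over its body variables, all written
with variables below `w` and finitely many predicates. Hence there are only finitely many sequents
`(B, a)`, "the bag `B` yields `a`", and each becomes a 0-ary predicate. A derivation step fires a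
tgd, passes to the child bag `B`, and returns some `a` over the body variables. It occurs in the
program as a rule on the data (`stepRule`) and as a propositional rule that derives new sequents
(`bagStepRule`). The program itself computes the true sequents, so producing it needs only finite
list operations and is primitive recursive (`primrec_rewriting`).

A match of a query need not lie in one bag. Therefore view atoms record that a subquery holds with
prescribed answer variables; the rules for evaluating and joining views are treated like tgds, so
view facts also travel through sequents.

Soundness (`certain_of_certain_program`): a model of the tgds becomes a model of the program when
views, sequents and the goal receive their intended meaning.

Completeness (`certain_program_of_certain`): from a model `M` of the program a tree-like model is
unfolded, with root bag `M` and one child per trigger. Closure under steps means that children add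
no atoms over the elements of their parent (`IsClosed.mem_of_root`). The image of a guard lies in
one bag, which forces the whole body of the tgd into that bag, so the tgds hold
(`treeModel_satisfies`). A query match in the tree is cut along subtrees and collected as a view
atom at the root (`viewAtom_mem`), which yields the goal in `M`. -/

namespace DatalogRew

open Encodable

/-! ### The program -/

/-- The variables of a finite instance, as a list. -/
def lvars (B : FinInstance) : List Var := B.flatMap Prod.snd

/-- All lists of length `n` over the list `L`. -/
def tuples (L : List ℕ) : ℕ → List (List ℕ)
  | 0 => [[]]
  | n + 1 => (tuples L n).flatMap fun t => L.map fun x => x :: t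

/-- A number above all members of a list. -/
def strictBound (l : List ℕ) : ℕ := l.foldr (fun a b => a + b + 1) 0

/-- The renaming given by a list. -/
def listFun (L : List ℕ) (v : Var) : Var := L.getD v 0

/-- The renaming of body variables to body variables given by a list. -/
def bodyFun (B : FinInstance) (L : List ℕ) (v : Var) : Var :=
  if v ∈ lvars B ∧ listFun L v ∈ lvars B then listFun L v else v

/-- The tgd obtained by identifying body variables. -/
def collapse (r : TGD) (L : List ℕ) : TGD :=
  (r.1.map (Atom.rename (bodyFun r.1 L)), r.2.map (Atom.rename (bodyFun r.1 L)))

/-- The atom stating that the query `q` with answer variables `Y` holds. -/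
def viewAtom (c : ℕ) (p : FinInstance × List Var) : Atom := (c + Nat.pair 1 (encode p), p.2)

/-- The propositional atom stating that the atom `p.2` follows from the instance `p.1`. -/
def seqAtom (c : ℕ) (p : FinInstance × Atom) : Atom := (c + Nat.pair 2 (encode p), [])

/-- The goal atom. -/
def goalAtom (c : ℕ) : Atom := (c + Nat.pair 0 0, [])

/-- All atoms of the input. -/
def inputAtoms (S : List TGD) (Q : List FinInstance) : List Atom :=
  (S.flatMap fun r => r.1 ++ r.2) ++ Q.flatten

/-- The subqueries of the given queries, with all choices of answer variables below `w`. -/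
def views (w : ℕ) (Q : List FinInstance) : List (FinInstance × List Var) :=
  (Q.flatMap List.sublists').product (List.range w).sublists'

/-- The rules that evaluate views. -/
def viewRules (c : ℕ) (V : List (FinInstance × List Var)) : List TGD :=
  (V.filter fun p => ∀ v ∈ p.2, v ∈ lvars p.1).map (fun p => (p.1, [viewAtom c p])) ++
  ((V.product (V.product V)).filter fun t =>
      (∀ v ∈ lvars t.1.1 ++ t.1.2, v ∈ lvars t.2.1.1 ++ t.2.1.2 → v ∈ t.1.2 ∧ v ∈ t.2.1.2) ∧
      (∀ a ∈ t.2.2.1, a ∈ t.1.1 ++ t.2.1.1) ∧ ∀ v ∈ t.2.2.2, v ∈ t.1.2 ++ t.2.1.2).map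
    fun t => ([viewAtom c t.1, viewAtom c t.2.1], [viewAtom c t.2.2])

/-- The rules that are applied in the bags of a tree-like model. -/
def bagRules (c w : ℕ) (S : List TGD) (Q : List FinInstance) : List TGD :=
  (S.flatMap fun r => (tuples (List.range w) w).map (collapse r)) ++ viewRules c (views w Q)

/-- The predicates of the atoms in the bags of a tree-like model. -/
def bagPreds (c w : ℕ) (S : List TGD) (Q : List FinInstance) : List Pred :=
  (inputAtoms S Q).map Atom.pred ++ (views w Q).map fun p => (viewAtom c p).pred

/-- The atoms over variables below `w` with given predicates. -/
def atomsOver (w : ℕ) (P : List Pred) : List Atom :=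
  P.flatMap fun p => (tuples (List.range w) p.2).map fun l => (p.1, l)

/-- The data of one derivation step: a tgd `t.1`, side atoms `t.2.1`, and a sequent `t.2.2` whose
premises are in the head of the tgd or side atoms. -/
def steps (R : List TGD) (At : List Atom) :
    List (TGD × FinInstance × FinInstance × Atom) :=
  (R.product (At.sublists'.product (At.sublists'.product At))).filter fun t =>
    (∀ a ∈ t.2.2.1, a ∈ t.1.2 ++ t.2.1) ∧ (∀ v ∈ lvars t.2.1, v ∈ lvars t.1.1) ∧
      ∀ v ∈ t.2.2.2.2, v ∈ lvars t.1.1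

/-- A derivation step as a Datalog rule. -/
def stepRule (c : ℕ) (t : TGD × FinInstance × FinInstance × Atom) : TGD :=
  (t.1.1 ++ t.2.1 ++ [seqAtom c t.2.2], [t.2.2.2])

/-- A derivation step, renamed by `p.2.2`, as a propositional rule on consequences of `p.2.1`. -/
def bagStepRule (c : ℕ)
    (p : (TGD × FinInstance × FinInstance × Atom) × FinInstance × List ℕ) : TGD :=
  ((p.1.1.1 ++ p.1.2.1).map (fun b => seqAtom c (p.2.1, b.rename (listFun p.2.2))) ++
      [seqAtom c p.1.2.2],
    [seqAtom c (p.2.1, p.1.2.2.2.rename (listFun p.2.2))])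

/-- The Datalog program, for a given list of steps and of bag atoms. -/
def programOf (c w : ℕ) (Q : List FinInstance) (At : List Atom)
    (T : List (TGD × FinInstance × FinInstance × Atom)) : List TGD :=
  Q.map (fun q => ([viewAtom c (q, [])], [goalAtom c])) ++
  ((At.sublists'.product At).filter fun p => p.2 ∈ p.1).map (fun p => ([], [seqAtom c p])) ++
  T.map (stepRule c) ++
  (T.product (At.sublists'.product (tuples (List.range w) w))).map (bagStepRule c)

/-- A number above all names of predicates of the input. -/
def nameBound (S : List TGD) (Q : List FinInstance) : ℕ :=
  strictBound ((inputAtoms S Q).map Prod.fst)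

/-- A number above all variables of the input. -/
def varBound (S : List TGD) (Q : List FinInstance) : ℕ := strictBound (lvars (inputAtoms S Q))

/-- The atoms in the bags of a tree-like model. -/
def bagAtoms (S : List TGD) (Q : List FinInstance) : List Atom :=
  atomsOver (varBound S Q) (bagPreds (nameBound S Q) (varBound S Q) S Q)

/-- The steps for the given input. -/
def inputSteps (S : List TGD) (Q : List FinInstance) :
    List (TGD × FinInstance × FinInstance × Atom) :=
  steps (bagRules (nameBound S Q) (varBound S Q) S Q) (bagAtoms S Q)

/-- The Datalog program for the given input. -/
def program (S : List TGD) (Q : List FinInstance) : List TGD :=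
  programOf (nameBound S Q) (varBound S Q) Q (bagAtoms S Q) (inputSteps S Q)

/-- The auxiliary predicates for the given input. -/
def auxPreds (S : List TGD) (Q : List FinInstance) : List Pred :=
  (goalAtom (nameBound S Q) :: ((program S Q).flatMap fun r => r.1 ++ r.2)).map Atom.pred |>.filter
    fun p => nameBound S Q ≤ p.1

/-- The Datalog rewriting for the given input. -/
def rewriting (x : List TGD × List FinInstance) : List Pred × List TGD × FinInstance :=
  (auxPreds x.1 x.2, program x.1 x.2, [goalAtom (nameBound x.1 x.2)])

/-! ### Computability -/

section Computability

open Primrec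

variable {α β γ : Type*} [Primcodable α] [Primcodable β] [Primcodable γ]

theorem primrec_list_product {f : α → List β} {g : α → List γ} (hf : Primrec f) (hg : Primrec g) :
    Primrec fun a => (f a).product (g a) :=
  list_flatMap hf (list_map (hg.comp fst) (Primrec₂.pair.comp (snd.comp fst) snd).to₂).to₂

theorem primrec_sublists' : Primrec (List.sublists' : List α → List (List α)) := by
  have h : Primrec fun l : List α =>
      l.foldr (fun a r => r ++ r.map fun t => a :: t) [[]] := by
    refine list_foldr (h := fun _ (x : α × List (List α)) => x.2 ++ x.2.map fun t => x.1 :: t) Primrec.id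
      (Primrec.const [[]]) (Primrec₂.mk ?_)
    refine list_append.comp (snd.comp snd) (list_map (snd.comp snd) (Primrec₂.mk ?_))
    exact list_cons.comp (fst.comp (snd.comp fst)) snd
  refine h.of_eq fun l => ?_
  induction l with
  | nil => rfl
  | cons a l ih => simp [List.sublists'_cons, ih]

theorem primrec_tuples {f : α → List ℕ} {g : α → ℕ} (hf : Primrec f) (hg : Primrec g) :
    Primrec fun a => tuples (f a) (g a) := by
  have h : Primrec fun a => (g a).rec (motive := fun _ => List (List ℕ)) [[]]
      fun _ r => r.flatMap fun t => (f a).map fun x => x :: t := by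
    refine nat_rec' (h := fun a x => x.2.flatMap fun t => (f a).map fun x => x :: t) hg
      (Primrec.const [[]]) (Primrec₂.mk ?_)
    refine list_flatMap (snd.comp snd) (Primrec₂.mk ?_)
    refine list_map (hf.comp (fst.comp fst)) (Primrec₂.mk ?_)
    exact list_cons.comp snd (snd.comp fst)
  refine h.of_eq fun a => ?_
  induction g a with
  | zero => rfl
  | succ n ih => simp only [ih, tuples]

theorem primrec_strictBound : Primrec strictBound :=
  list_foldr (h := fun _ x => x.1 + x.2 + 1) Primrec.id (Primrec.const 0)
    (Primrec₂.mk (succ.comp (nat_add.comp (fst.comp snd) (snd.comp snd))))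

theorem primrec_lvars : Primrec lvars := list_flatMap Primrec.id (Primrec₂.mk (snd.comp snd))

theorem primrecPred_mem {f : α → β} {g : α → List β} (hf : Primrec f) (hg : Primrec g) :
    PrimrecPred fun a => f a ∈ g a := by
  have h : PrimrecRel fun (L : List β) (b : β) => ∃ x ∈ L, x = b :=
    PrimrecRel.exists_mem_list Primrec.eq
  exact (h.comp hg hf).of_eq fun a => by simp

theorem primrecPred_forall_mem {f : α → List β} {p : β → α → Prop} (hf : Primrec f)
    (hp : PrimrecRel p) : PrimrecPred fun a => ∀ b ∈ f a, p b a :=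
  (PrimrecRel.forall_mem_list hp).comp hf Primrec.id

theorem primrecPred_subset {f g : α → List β} (hf : Primrec f) (hg : Primrec g) :
    PrimrecPred fun a => ∀ x ∈ f a, x ∈ g a :=
  primrecPred_forall_mem hf
    (PrimrecPred.primrecRel (primrecPred_mem fst (hg.comp snd)))

theorem primrec_listFun : Primrec₂ listFun := Primrec.list_getD 0

theorem primrec_rename {σ : α → Var → Var} {f : α → Atom} (hσ : Primrec₂ σ) (hf : Primrec f) :
    Primrec fun a => (f a).rename (σ a) :=
  Primrec₂.pair.comp (fst.comp hf) (list_map (snd.comp hf) hσ)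

theorem primrec_collapse : Primrec₂ collapse := by
  have h : Primrec₂ fun (p : TGD × List ℕ) v => bodyFun p.1.1 p.2 v := by
    have hl : Primrec fun x : (TGD × List ℕ) × ℕ => listFun x.1.2 x.2 :=
      primrec_listFun.comp (snd.comp fst) snd
    have hB : Primrec fun x : (TGD × List ℕ) × ℕ => lvars x.1.1.1 :=
      primrec_lvars.comp (fst.comp (fst.comp fst))
    exact Primrec.ite ((primrecPred_mem snd hB).and (primrecPred_mem hl hB)) hl snd
  have h' : Primrec₂ fun (x : (TGD × List ℕ) × Atom) v => bodyFun x.1.1.1 x.1.2 v :=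
    h.comp (fst.comp fst) snd
  exact Primrec₂.pair.comp
    (list_map (fst.comp fst) (Primrec₂.mk (primrec_rename h' snd)))
    (list_map (snd.comp fst) (Primrec₂.mk (primrec_rename h' snd)))

theorem primrec_viewAtom : Primrec₂ viewAtom :=
  Primrec₂.pair.comp (nat_add.comp fst (Primrec₂.natPair.comp (Primrec.const 1)
    (Primrec.encode.comp snd))) (snd.comp snd)

theorem primrec_seqAtom : Primrec₂ seqAtom :=
  Primrec₂.pair.comp (nat_add.comp fst (Primrec₂.natPair.comp (Primrec.const 2)
    (Primrec.encode.comp snd))) (Primrec.const [])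

theorem primrec_goalAtom : Primrec goalAtom :=
  Primrec₂.pair.comp (nat_add.comp Primrec.id (Primrec.const _)) (Primrec.const [])

theorem primrec_inputAtoms : Primrec₂ inputAtoms :=
  list_append.comp
    (list_flatMap fst (Primrec₂.mk (list_append.comp (fst.comp snd) (snd.comp snd))))
    (list_flatten.comp snd)

theorem primrec_atom_pred : Primrec Atom.pred := Primrec₂.pair.comp fst (list_length.comp snd)

theorem primrec_views : Primrec₂ views :=
  primrec_list_product (list_flatMap snd (Primrec₂.mk (primrec_sublists'.comp snd)))
    (primrec_sublists'.comp (list_range.comp fst))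

theorem primrec_singleton {f : α → β} (hf : Primrec f) : Primrec fun a => [f a] :=
  list_cons.comp hf (Primrec.const [])

theorem primrec_viewRules : Primrec₂ viewRules := by
  refine list_append.comp (list_map ((listFilter ?_).comp snd) (Primrec₂.mk ?_))
    (list_map ((listFilter ?_).comp ?_) (Primrec₂.mk ?_))
  · exact primrecPred_subset snd (primrec_lvars.comp fst)
  · exact Primrec₂.pair.comp (fst.comp snd)
      (primrec_singleton (primrec_viewAtom.comp (fst.comp fst) snd))
  · refine PrimrecPred.and ?_ (PrimrecPred.and ?_ ?_)
    · refine primrecPred_forall_mem (list_append.comp (primrec_lvars.comp (fst.comp fst))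
        (snd.comp fst)) ?_
      -- The implication is replaced by a disjunction, since closure is applied for negation,
      -- conjunction and disjunction.
      refine PrimrecPred.of_eq (α := Var × (FinInstance × List Var) × (FinInstance × List Var) ×
        FinInstance × List Var) (PrimrecPred.or (PrimrecPred.not (primrecPred_mem fst
        (list_append.comp (primrec_lvars.comp (fst.comp (fst.comp (snd.comp snd))))
          (snd.comp (fst.comp (snd.comp snd))))))
        (PrimrecPred.and (primrecPred_mem fst (snd.comp (fst.comp snd)))
          (primrecPred_mem fst (snd.comp (fst.comp (snd.comp snd)))))) fun x => ?_
      exact imp_iff_not_or.symm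
    · exact primrecPred_subset (fst.comp (snd.comp snd))
        (list_append.comp (fst.comp fst) (fst.comp (fst.comp snd)))
    · exact primrecPred_subset (snd.comp (snd.comp snd))
        (list_append.comp (snd.comp fst) (snd.comp (fst.comp snd)))
  · exact primrec_list_product snd (primrec_list_product snd snd)
  · have hc : Primrec fun x : (ℕ × List (FinInstance × List Var)) ×
        ((FinInstance × List Var) × (FinInstance × List Var) × (FinInstance × List Var)) =>
        x.1.1 := fst.comp fst
    exact Primrec₂.pair.comp (list_cons.comp (primrec_viewAtom.comp hc (fst.comp snd))
      (primrec_singleton (primrec_viewAtom.comp hc (fst.comp (snd.comp snd)))))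
      (primrec_singleton (primrec_viewAtom.comp hc (snd.comp (snd.comp snd))))

theorem primrec_nameBound : Primrec₂ nameBound :=
  primrec_strictBound.comp (list_map primrec_inputAtoms (Primrec₂.mk (fst.comp snd)))

theorem primrec_varBound : Primrec₂ varBound :=
  primrec_strictBound.comp (primrec_lvars.comp primrec_inputAtoms)

theorem primrec_bagRules :
    Primrec fun x : List TGD × List FinInstance =>
      bagRules (nameBound x.1 x.2) (varBound x.1 x.2) x.1 x.2 := by
  refine list_append.comp (list_flatMap fst (Primrec₂.mk (list_map ?_ (Primrec₂.mk ?_)))) ?_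
  · have h : Primrec fun x : (List TGD × List FinInstance) × TGD => varBound x.1.1 x.1.2 :=
      Primrec.comp (f := fun x : List TGD × List FinInstance => varBound x.1 x.2)
        primrec_varBound fst
    exact primrec_tuples (list_range.comp h) h
  · exact primrec_collapse.comp (snd.comp fst) snd
  · exact primrec_viewRules.comp primrec_nameBound (primrec_views.comp primrec_varBound snd)

theorem primrec_bagAtoms : Primrec₂ bagAtoms := by
  refine list_flatMap (list_append.comp (list_map primrec_inputAtoms
    (Primrec₂.mk (primrec_atom_pred.comp snd)))
      (list_map (primrec_views.comp primrec_varBound snd)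
    (Primrec₂.mk (primrec_atom_pred.comp (primrec_viewAtom.comp ?_ snd)))))
    (Primrec₂.mk (list_map (primrec_tuples (list_range.comp ?_) (snd.comp snd))
      (Primrec₂.mk (Primrec₂.pair.comp (fst.comp (snd.comp fst)) snd))))
  · exact Primrec.comp (f := fun x : List TGD × List FinInstance => nameBound x.1 x.2)
      primrec_nameBound fst
  · exact Primrec.comp (f := fun x : List TGD × List FinInstance => varBound x.1 x.2)
      primrec_varBound fst

theorem primrec_steps : Primrec₂ steps := by
  refine (listFilter (PrimrecPred.and ?_ (PrimrecPred.and ?_ ?_))).comp ?_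
  · exact primrecPred_subset (fst.comp (snd.comp snd))
      (list_append.comp (snd.comp fst) (fst.comp snd))
  · exact primrecPred_subset (primrec_lvars.comp (fst.comp snd))
      (primrec_lvars.comp (fst.comp fst))
  · exact primrecPred_subset (snd.comp (snd.comp (snd.comp snd)))
      (primrec_lvars.comp (fst.comp fst))
  · exact primrec_list_product fst (primrec_list_product (primrec_sublists'.comp snd)
      (primrec_list_product (primrec_sublists'.comp snd) snd))

theorem primrec_inputSteps : Primrec₂ inputSteps :=
  primrec_steps.comp primrec_bagRules primrec_bagAtoms

theorem primrec_stepRule : Primrec₂ stepRule :=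
  Primrec₂.pair.comp (list_append.comp (list_append.comp (fst.comp (fst.comp snd))
      (fst.comp (snd.comp snd)))
    (primrec_singleton (primrec_seqAtom.comp fst (snd.comp (snd.comp snd)))))
    (primrec_singleton (snd.comp (snd.comp (snd.comp snd))))

theorem primrec_bagStepRule : Primrec₂ bagStepRule := by
  have hL : Primrec₂ fun (x : (ℕ × (TGD × FinInstance × FinInstance × Atom) × FinInstance ×
      List ℕ)) v => listFun x.2.2.2 v :=
    primrec_listFun.comp (snd.comp (snd.comp (snd.comp fst))) snd
  refine Primrec₂.pair.comp (list_append.comp (list_map (list_append.comp ?_ ?_)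
    (Primrec₂.mk (primrec_seqAtom.comp (fst.comp fst) (Primrec₂.pair.comp ?_
      (primrec_rename (hL.comp (fst.comp fst) snd) snd)))))
    (primrec_singleton (primrec_seqAtom.comp fst ?_)))
    (primrec_singleton (primrec_seqAtom.comp fst (Primrec₂.pair.comp ?_
      (primrec_rename hL ?_))))
  · exact fst.comp (fst.comp (fst.comp snd))
  · exact fst.comp (snd.comp (fst.comp snd))
  · exact fst.comp (snd.comp (snd.comp fst))
  · exact snd.comp (snd.comp (fst.comp snd))
  · exact fst.comp (snd.comp snd)
  · exact snd.comp (snd.comp (snd.comp (fst.comp snd)))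

theorem primrec_program : Primrec₂ program := by
  have hc : ∀ {δ : Type} [Primcodable δ],
      Primrec fun x : (List TGD × List FinInstance) × δ => nameBound x.1.1 x.1.2 :=
    Primrec.comp (f := fun x : List TGD × List FinInstance => nameBound x.1 x.2)
      primrec_nameBound fst
  refine list_append.comp (list_append.comp (list_append.comp ?_ ?_) ?_) ?_
  · exact list_map snd (Primrec₂.mk (Primrec₂.pair.comp
      (primrec_singleton (primrec_viewAtom.comp hc
        (Primrec₂.pair.comp snd (Primrec.const []))))
      (primrec_singleton (primrec_goalAtom.comp hc))))
  · exact list_map ((listFilter (primrecPred_mem snd fst)).comp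
      (primrec_list_product (primrec_sublists'.comp primrec_bagAtoms) primrec_bagAtoms))
      (Primrec₂.mk (Primrec₂.pair.comp (Primrec.const [])
        (primrec_singleton (primrec_seqAtom.comp hc snd))))
  · exact list_map primrec_inputSteps (Primrec₂.mk (primrec_stepRule.comp hc snd))
  · exact list_map (primrec_list_product primrec_inputSteps
      (primrec_list_product (primrec_sublists'.comp primrec_bagAtoms)
        (primrec_tuples (list_range.comp primrec_varBound) primrec_varBound)))
      (Primrec₂.mk (primrec_bagStepRule.comp hc snd))

theorem primrec_auxPreds : Primrec₂ auxPreds := by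
  have h : Primrec fun x : List TGD × List FinInstance =>
      (goalAtom (nameBound x.1 x.2) :: ((program x.1 x.2).flatMap fun r => r.1 ++ r.2)).map
        Atom.pred :=
    list_map (list_cons.comp (primrec_goalAtom.comp primrec_nameBound)
      (list_flatMap primrec_program
        (Primrec₂.mk (list_append.comp (fst.comp snd) (snd.comp snd)))))
      (Primrec₂.mk (primrec_atom_pred.comp snd))
  have h' : PrimrecRel fun (p : Pred) (n : ℕ) => n ≤ p.1 :=
    PrimrecPred.primrecRel (nat_le.comp snd (fst.comp fst))
  exact (PrimrecRel.listFilter h').comp h primrec_nameBound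

theorem primrec_rewriting : Primrec rewriting :=
  Primrec₂.pair.comp primrec_auxPreds (Primrec₂.pair.comp primrec_program
    (primrec_singleton (primrec_goalAtom.comp primrec_nameBound)))

end Computability

/-! ### Basic facts -/

theorem rename_subset_iff {θ : Var → Var} {B : FinInstance} {M : Instance} :
    rename θ B.toInstance ⊆ M ↔ ∀ a ∈ B, a.rename θ ∈ M :=
  Set.image_subset_iff

theorem mem_lvars {B : FinInstance} {v : Var} : v ∈ lvars B ↔ ∃ a ∈ B, v ∈ a.2 :=
  List.mem_flatMap

theorem mem_vars_toInstance {B : FinInstance} {v : Var} : v ∈ vars B.toInstance ↔ v ∈ lvars B :=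
  mem_lvars.symm

theorem satisfies_iff {M : Instance} {r : TGD} :
    Satisfies M r ↔ ∀ θ : Var → Var, (∀ a ∈ r.1, a.rename θ ∈ M) →
      ∃ η : Var → Var, (∀ v ∈ lvars r.1, v ∈ lvars r.2 → η v = θ v) ∧
        ∀ a ∈ r.2, a.rename η ∈ M := by
  simp only [Satisfies, TGD.body, TGD.head, rename_subset_iff, Set.mem_inter_iff,
    mem_vars_toInstance, and_imp]

@[simp] theorem rename_fst (θ : Var → Var) (a : Atom) : (a.rename θ).1 = a.1 := rfl

@[simp] theorem rename_snd (θ : Var → Var) (a : Atom) : (a.rename θ).2 = a.2.map θ := rfl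

@[simp] theorem rename_pred (θ : Var → Var) (a : Atom) : (a.rename θ).pred = a.pred := by
  simp [Atom.pred]

theorem rename_rename (θ σ : Var → Var) (a : Atom) : (a.rename σ).rename θ = a.rename (θ ∘ σ) := by
  simp [Atom.rename]

theorem rename_congr {θ σ : Var → Var} {a : Atom} (h : ∀ v ∈ a.2, θ v = σ v) :
    a.rename θ = a.rename σ :=
  Prod.ext rfl (List.map_congr_left h)

@[simp] theorem rename_goalAtom (θ : Var → Var) (c : ℕ) : (goalAtom c).rename θ = goalAtom c := rfl

theorem mem_tuples {L : List ℕ} {n : ℕ} {l : List ℕ} :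
    l ∈ tuples L n ↔ l.length = n ∧ ∀ x ∈ l, x ∈ L := by
  induction n generalizing l with
  | zero => simp +contextual [tuples]
  | succ n ih =>
    cases l with
    | nil => simp [tuples]
    | cons a l => simp [tuples, ih]; tauto

theorem lt_strictBound {l : List ℕ} {a : ℕ} (h : a ∈ l) : a < strictBound l := by
  induction l with
  | nil => simp at h
  | cons b l ih =>
    simp only [strictBound, List.foldr_cons] at ih ⊢
    rcases List.mem_cons.1 h with rfl | h
    · omega
    · have := ih h
      omega

theorem mem_atomsOver {w : ℕ} {P : List Pred} {a : Atom} :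
    a ∈ atomsOver w P ↔ a.pred ∈ P ∧ ∀ v ∈ a.2, v < w := by
  simp only [atomsOver, List.mem_flatMap, List.mem_map, mem_tuples, List.mem_range]
  constructor
  · rintro ⟨p, hp, l, ⟨h1, h2⟩, rfl⟩
    refine ⟨?_, h2⟩
    rwa [show Atom.pred (p.1, l) = p from Prod.ext rfl h1]
  · rintro ⟨h1, h2⟩
    exact ⟨_, h1, a.2, ⟨rfl, h2⟩, rfl⟩

theorem mem_list_product {α β : Type*} {l : List α} {m : List β} {a : α} {b : β} :
    (a, b) ∈ l.product m ↔ a ∈ l ∧ b ∈ m :=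
  List.mem_product

theorem bodyFun_of_not_mem {B : FinInstance} {L : List ℕ} {v : Var} (h : v ∉ lvars B) :
    bodyFun B L v = v := by simp [bodyFun, h]

theorem bodyFun_mem {B : FinInstance} {L : List ℕ} {v : Var} (h : v ∈ lvars B) :
    bodyFun B L v ∈ lvars B := by
  unfold bodyFun
  split_ifs with h'
  exacts [h'.2, h]

theorem mem_lvars_map_rename {B : FinInstance} {σ : Var → Var} {v : Var} :
    v ∈ lvars (B.map (Atom.rename σ)) ↔ ∃ u ∈ lvars B, σ u = v := by
  simp only [mem_lvars, List.mem_map]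
  constructor
  · rintro ⟨_, ⟨a, ha, rfl⟩, hv⟩
    obtain ⟨u, hu, rfl⟩ := List.mem_map.1 hv
    exact ⟨u, ⟨a, ha, hu⟩, rfl⟩
  · rintro ⟨u, ⟨a, ha, hu⟩, rfl⟩
    exact ⟨_, ⟨a, ha, rfl⟩, List.mem_map_of_mem hu⟩

theorem mem_views {w : ℕ} {Q : List FinInstance} {p : FinInstance × List Var} :
    p ∈ views w Q ↔ (∃ q ∈ Q, p.1.Sublist q) ∧ p.2.Sublist (List.range w) := by
  obtain ⟨q, Y⟩ := p
  simp [views, List.mem_flatMap]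

/-- The condition under which views `p` and `p'` yield the view `s`. -/
def Joinable (p p' s : FinInstance × List Var) : Prop :=
  (∀ v ∈ lvars p.1 ++ p.2, v ∈ lvars p'.1 ++ p'.2 → v ∈ p.2 ∧ v ∈ p'.2) ∧
    (∀ a ∈ s.1, a ∈ p.1 ++ p'.1) ∧ ∀ v ∈ s.2, v ∈ p.2 ++ p'.2

theorem mem_viewRules {c : ℕ} {V : List (FinInstance × List Var)} {r : TGD} :
    r ∈ viewRules c V ↔
      (∃ p ∈ V, (∀ v ∈ p.2, v ∈ lvars p.1) ∧ r = (p.1, [viewAtom c p])) ∨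
      ∃ p ∈ V, ∃ p' ∈ V, ∃ s ∈ V, Joinable p p' s ∧
        r = ([viewAtom c p, viewAtom c p'], [viewAtom c s]) := by
  simp only [viewRules, List.mem_append, List.mem_map, List.mem_filter, decide_eq_true_eq]
  refine or_congr ?_ ?_
  · constructor
    · rintro ⟨p, ⟨h1, h2⟩, rfl⟩
      exact ⟨p, h1, h2, rfl⟩
    · rintro ⟨p, h1, h2, rfl⟩
      exact ⟨p, ⟨h1, h2⟩, rfl⟩
  · constructor
    · rintro ⟨⟨p, p', s⟩, ⟨h1, h2⟩, rfl⟩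
      rw [mem_list_product, mem_list_product] at h1
      refine ⟨p, h1.1, p', h1.2.1, s, h1.2.2, ?_, rfl⟩
      simpa only [Joinable, List.mem_append] using h2
    · rintro ⟨p, h1, p', h2, s, h3, h4, rfl⟩
      refine ⟨(p, p', s), ⟨mem_list_product.2 ⟨h1, mem_list_product.2 ⟨h2, h3⟩⟩, ?_⟩, rfl⟩
      simpa only [Joinable, List.mem_append] using h4

theorem mem_steps {R : List TGD} {At : List Atom} {r : TGD} {F B : FinInstance} {a : Atom} :
    (r, F, B, a) ∈ steps R At ↔ (r ∈ R ∧ F.Sublist At ∧ B.Sublist At ∧ a ∈ At) ∧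
      (∀ b ∈ B, b ∈ r.2 ++ F) ∧ (∀ v ∈ lvars F, v ∈ lvars r.1) ∧ ∀ v ∈ a.2, v ∈ lvars r.1 := by
  simp [steps]

/-! ### Membership in the constituents of the program -/

section Input

variable {S : List TGD} {Q : List FinInstance}

theorem mem_inputAtoms {a : Atom} :
    a ∈ inputAtoms S Q ↔ (∃ r ∈ S, a ∈ r.1 ∨ a ∈ r.2) ∨ ∃ q ∈ Q, a ∈ q := by
  simp [inputAtoms, List.mem_flatMap]

theorem name_lt_nameBound {a : Atom} (h : a ∈ inputAtoms S Q) : a.1 < nameBound S Q :=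
  lt_strictBound (List.mem_map_of_mem h)

theorem var_lt_varBound {a : Atom} (h : a ∈ inputAtoms S Q) {v : Var} (hv : v ∈ a.2) :
    v < varBound S Q :=
  lt_strictBound (mem_lvars.2 ⟨a, h, hv⟩)

theorem mem_bagAtoms {a : Atom} : a ∈ bagAtoms S Q ↔
    a.pred ∈ bagPreds (nameBound S Q) (varBound S Q) S Q ∧ ∀ v ∈ a.2, v < varBound S Q :=
  mem_atomsOver

theorem mem_bagPreds {c w : ℕ} {p : Pred} : p ∈ bagPreds c w S Q ↔
    (∃ a ∈ inputAtoms S Q, a.pred = p) ∨ ∃ s ∈ views w Q, (viewAtom c s).pred = p := by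
  simp [bagPreds]

theorem mem_bagRules {c w : ℕ} {r : TGD} : r ∈ bagRules c w S Q ↔
    (∃ r' ∈ S, ∃ L ∈ tuples (List.range w) w, collapse r' L = r) ∨
      r ∈ viewRules c (views w Q) := by
  simp [bagRules, List.mem_flatMap]

theorem mem_program {r : TGD} : r ∈ program S Q ↔
    (∃ q ∈ Q, r = ([viewAtom (nameBound S Q) (q, [])], [goalAtom (nameBound S Q)])) ∨
    (∃ B : FinInstance, ∃ a, B.Sublist (bagAtoms S Q) ∧ a ∈ B ∧
      r = ([], [seqAtom (nameBound S Q) (B, a)])) ∨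
    (∃ t ∈ inputSteps S Q, r = stepRule (nameBound S Q) t) ∨
    ∃ t ∈ inputSteps S Q, ∃ B : FinInstance, B.Sublist (bagAtoms S Q) ∧
      ∃ L ∈ tuples (List.range (varBound S Q)) (varBound S Q),
        r = bagStepRule (nameBound S Q) (t, B, L) := by
  simp only [program, programOf, List.mem_append, List.mem_map, List.mem_filter, or_assoc,
    decide_eq_true_eq]
  refine or_congr ?_ (or_congr ?_ (or_congr ?_ ?_))
  · exact exists_congr fun q => and_congr_right fun _ => eq_comm
  · constructor
    · rintro ⟨⟨B, a⟩, ⟨h1, h2⟩, rfl⟩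
      rw [mem_list_product, List.mem_sublists'] at h1
      exact ⟨B, a, h1.1, h2, rfl⟩
    · rintro ⟨B, a, h1, h2, rfl⟩
      exact ⟨(B, a), ⟨mem_list_product.2 ⟨List.mem_sublists'.2 h1, h1.subset h2⟩, h2⟩, rfl⟩
  · exact exists_congr fun q => and_congr_right fun _ => eq_comm
  · constructor
    · rintro ⟨⟨t, B, L⟩, h, rfl⟩
      rw [mem_list_product, mem_list_product, List.mem_sublists'] at h
      exact ⟨t, h.1, B, h.2.1, L, h.2.2, rfl⟩
    · rintro ⟨t, ht, B, hB, L, hL, rfl⟩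
      exact ⟨(t, B, L), mem_list_product.2 ⟨ht, mem_list_product.2
        ⟨List.mem_sublists'.2 hB, hL⟩⟩, rfl⟩

theorem mem_auxPreds {p : Pred} : p ∈ auxPreds S Q ↔
    ((goalAtom (nameBound S Q)).pred = p ∨ ∃ r ∈ program S Q, ∃ a, (a ∈ r.1 ∨ a ∈ r.2) ∧
      a.pred = p) ∧ nameBound S Q ≤ p.1 := by
  simp only [auxPreds, List.mem_filter, List.map_cons, List.mem_cons, List.mem_map,
    List.mem_flatMap, List.mem_append, decide_eq_true_eq]
  refine and_congr_left fun _ => or_congr eq_comm ?_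
  constructor
  · rintro ⟨a, ⟨r, hr, ha⟩, rfl⟩
    exact ⟨r, hr, a, ha, rfl⟩
  · rintro ⟨r, hr, a, ha, rfl⟩
    exact ⟨a, ⟨r, hr, ha⟩, rfl⟩

theorem mem_inputAtoms_of_subquery {w : ℕ} {p : FinInstance × List Var} (hp : p ∈ views w Q)
    {a : Atom} (ha : a ∈ p.1) : a ∈ inputAtoms S Q := by
  obtain ⟨⟨q, hq, hs⟩, -⟩ := mem_views.1 hp
  exact mem_inputAtoms.2 (Or.inr ⟨q, hq, hs.subset ha⟩)

/-! ### Soundness -/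

/-- The offset `c` keeps new names above those of the input, the tags 0, 1, 2 separate goal, views
and sequents, and the encoding recovers the data. The name alone therefore determines which
auxiliary atom is meant. -/
theorem viewAtom_inj {c : ℕ} {p p' : FinInstance × List Var}
    (h : (viewAtom c p).1 = (viewAtom c p').1) : p = p' :=
  encode_injective (Nat.pair_eq_pair.1 (Nat.add_left_cancel h)).2

theorem seqAtom_inj {c : ℕ} {p p' : FinInstance × Atom}
    (h : (seqAtom c p).1 = (seqAtom c p').1) : p = p' :=
  encode_injective (Nat.pair_eq_pair.1 (Nat.add_left_cancel h)).2

theorem viewAtom_ne_seqAtom {c : ℕ} {p : FinInstance × List Var} {p' : FinInstance × Atom} :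
    (viewAtom c p).1 ≠ (seqAtom c p').1 := fun h =>
  absurd (Nat.pair_eq_pair.1 (Nat.add_left_cancel h)).1 (by decide)

theorem viewAtom_ne_goalAtom {c : ℕ} {p : FinInstance × List Var} :
    (viewAtom c p).1 ≠ (goalAtom c).1 := fun h =>
  absurd (Nat.pair_eq_pair.1 (Nat.add_left_cancel h)).1 (by decide)

theorem seqAtom_ne_goalAtom {c : ℕ} {p : FinInstance × Atom} :
    (seqAtom c p).1 ≠ (goalAtom c).1 := fun h =>
  absurd (Nat.pair_eq_pair.1 (Nat.add_left_cancel h)).1 (by decide)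

theorem le_viewAtom (c : ℕ) (p : FinInstance × List Var) : c ≤ (viewAtom c p).1 :=
  Nat.le_add_right _ _

theorem le_seqAtom (c : ℕ) (p : FinInstance × Atom) : c ≤ (seqAtom c p).1 := Nat.le_add_right _ _

theorem le_goalAtom (c : ℕ) : c ≤ (goalAtom c).1 := Nat.le_add_right _ _

/-- The part of an instance with names below `c`, together with the true view atoms. -/
def viewModel (c : ℕ) (M : Instance) : Instance :=
  {a | a.1 < c ∧ a ∈ M} ∪
    {a | ∃ (p : FinInstance × List Var) (ρ : Var → Var), a = (viewAtom c p).rename ρ ∧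
      ∀ b ∈ p.1, b.rename ρ ∈ M}

/-- The sequent `p` holds in `M`. -/
def SeqHolds (M : Instance) (p : FinInstance × Atom) : Prop :=
  ∀ θ : Var → Var, (∀ b ∈ p.1, b.rename θ ∈ M) → p.2.rename θ ∈ M

/-- The view model, together with the true sequents and the goal if `g` holds. -/
def auxModel (c : ℕ) (M : Instance) (g : Prop) : Instance :=
  viewModel c M ∪ {a | ∃ p, a = seqAtom c p ∧ SeqHolds (viewModel c M) p} ∪
    {a | a = goalAtom c ∧ g}

theorem mem_viewModel_of_lt {c : ℕ} {M : Instance} {a : Atom} (h : a.1 < c) :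
    a ∈ viewModel c M ↔ a ∈ M := by
  refine ⟨?_, fun h' => Or.inl ⟨h, h'⟩⟩
  rintro (h' | ⟨p, ρ, rfl, -⟩)
  · exact h'.2
  · exact absurd h (le_viewAtom c p).not_gt

theorem viewAtom_mem_viewModel {c : ℕ} {M : Instance} {p : FinInstance × List Var}
    {θ : Var → Var} : (viewAtom c p).rename θ ∈ viewModel c M ↔
      ∃ ρ : Var → Var, (∀ v ∈ p.2, ρ v = θ v) ∧ ∀ b ∈ p.1, b.rename ρ ∈ M := by
  constructor
  · rintro (h | ⟨p', ρ, h, h'⟩)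
    · exact absurd h.1 (le_viewAtom c p).not_gt
    · obtain rfl : p = p' := viewAtom_inj (c := c) (congrArg Prod.fst h :)
      refine ⟨ρ, fun v hv => ?_, h'⟩
      exact (List.map_inj_left.1 (congrArg Prod.snd h) v hv).symm
  · rintro ⟨ρ, h, h'⟩
    exact Or.inr ⟨p, ρ, rename_congr fun v hv => (h v hv).symm, h'⟩

theorem mem_auxModel_of_not_aux {c : ℕ} {M : Instance} {g : Prop} {a : Atom}
    (h : ∀ p, a.1 ≠ (seqAtom c p).1) (h' : a.1 ≠ (goalAtom c).1) :
    a ∈ auxModel c M g ↔ a ∈ viewModel c M := by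
  refine ⟨?_, fun h => Or.inl (Or.inl h)⟩
  rintro ((h1 | ⟨p, rfl, -⟩) | ⟨rfl, -⟩)
  · exact h1
  · exact absurd rfl (h p)
  · exact absurd rfl h'

theorem mem_auxModel_of_lt {c : ℕ} {M : Instance} {g : Prop} {a : Atom} (h : a.1 < c) :
    a ∈ auxModel c M g ↔ a ∈ M := by
  rw [mem_auxModel_of_not_aux, mem_viewModel_of_lt h]
  · exact fun p => (h.trans_le (le_seqAtom c p)).ne
  · exact (h.trans_le (le_goalAtom c)).ne

theorem seqAtom_mem_auxModel {c : ℕ} {M : Instance} {g : Prop} {p : FinInstance × Atom} :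
    seqAtom c p ∈ auxModel c M g ↔ SeqHolds (viewModel c M) p := by
  refine ⟨?_, fun h => Or.inl (Or.inr ⟨p, rfl, h⟩)⟩
  rintro (((h | ⟨p', ρ, h, -⟩) | ⟨p', h, h'⟩) | ⟨h, -⟩)
  · exact absurd h.1 (le_seqAtom c p).not_gt
  · exact absurd (congrArg Prod.fst h).symm viewAtom_ne_seqAtom
  · rwa [seqAtom_inj (congrArg Prod.fst h)]
  · exact absurd (congrArg Prod.fst h) seqAtom_ne_goalAtom

theorem goalAtom_mem_auxModel {c : ℕ} {M : Instance} {g : Prop} :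
    goalAtom c ∈ auxModel c M g ↔ g := by
  refine ⟨?_, fun h => Or.inr ⟨rfl, h⟩⟩
  rintro (((h | ⟨p', ρ, h, -⟩) | ⟨p', h, h'⟩) | ⟨-, h⟩)
  · exact absurd h.1 (le_goalAtom c).not_gt
  · exact absurd (congrArg Prod.fst h).symm viewAtom_ne_goalAtom
  · exact absurd (congrArg Prod.fst h).symm seqAtom_ne_goalAtom
  · exact h

/-- A valuation of the collapsed body composes with `bodyFun` to a valuation of the original one.
Existential variables are fixed by `bodyFun`, and body variables stay body variables, so the two
kinds never merge. -/
theorem satisfies_collapse {M : Instance} {r : TGD} (h : Satisfies M r) (L : List ℕ) :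
    Satisfies M (collapse r L) := by
  rw [satisfies_iff] at h ⊢
  intro θ hθ
  obtain ⟨η, h1, h2⟩ := h (θ ∘ bodyFun r.1 L) fun a ha => by
    rw [← rename_rename]
    exact hθ _ (List.mem_map_of_mem ha)
  refine ⟨fun v => if v ∈ lvars r.1 then θ v else η v, fun v hv _ => ?_, fun a ha => ?_⟩
  · obtain ⟨u, hu, rfl⟩ := mem_lvars_map_rename.1 hv
    simp [bodyFun_mem hu]
  · obtain ⟨b, hb, rfl⟩ := List.mem_map.1 ha
    rw [rename_rename]
    convert h2 b hb using 1
    refine rename_congr fun v hv => ?_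
    by_cases hv' : v ∈ lvars r.1
    · simp [bodyFun_mem hv', h1 v hv' (mem_lvars.2 ⟨b, hb, hv⟩)]
    · simp [bodyFun_of_not_mem hv', hv']

theorem viewModel_satisfies_viewRules {c w : ℕ} {M : Instance}
    (hc : ∀ q ∈ Q, ∀ a ∈ q, a.1 < c) {r : TGD} (hr : r ∈ viewRules c (views w Q)) :
    Satisfies (viewModel c M) r := by
  rw [satisfies_iff]
  intro θ hθ
  rcases mem_viewRules.1 hr with ⟨p, hp, -, rfl⟩ | ⟨p, -, p', -, s, -, ⟨h1, h2, h3⟩, rfl⟩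
  · refine ⟨θ, fun _ _ _ => rfl, List.forall_mem_singleton.2 ?_⟩
    refine viewAtom_mem_viewModel.2 ⟨θ, fun _ _ => rfl, fun b hb => ?_⟩
    obtain ⟨⟨q, hq, hs⟩, -⟩ := mem_views.1 hp
    exact (mem_viewModel_of_lt (a := b.rename θ) (hc q hq b (hs.subset hb))).1 (hθ b hb)
  · refine ⟨θ, fun _ _ _ => rfl, List.forall_mem_singleton.2 ?_⟩
    obtain ⟨ρ, hρ, hρM⟩ := viewAtom_mem_viewModel.1 (hθ (viewAtom c p) (by simp))
    obtain ⟨ρ', hρ', hρM'⟩ := viewAtom_mem_viewModel.1 (hθ (viewAtom c p') (by simp))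
    -- The witnesses of the two views glue: a shared variable is an answer variable of both, so both
    -- witnesses agree there with `θ`.
    have key : ∀ v ∈ lvars p'.1 ++ p'.2,
        (if v ∈ lvars p.1 ++ p.2 then ρ v else ρ' v) = ρ' v := by
      intro v hv
      split_ifs with h
      · rw [hρ v (h1 v h hv).1, hρ' v (h1 v h hv).2]
      · rfl
    refine viewAtom_mem_viewModel.2
      ⟨fun v => if v ∈ lvars p.1 ++ p.2 then ρ v else ρ' v, fun v hv => ?_, fun b hb => ?_⟩
    · rcases List.mem_append.1 (h3 v hv) with h | h
      · simp only [List.mem_append, h, or_true, if_true, hρ v h]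
      · exact (key v (List.mem_append_right _ h)).trans (hρ' v h)
    · rcases List.mem_append.1 (h2 b hb) with h | h
      · convert hρM b h using 1
        refine rename_congr fun v hv => ?_
        rw [if_pos (List.mem_append_left _ (mem_lvars.2 ⟨b, h, hv⟩))]
      · convert hρM' b h using 1
        exact rename_congr fun v hv => key v (List.mem_append_left _ (mem_lvars.2 ⟨b, h, hv⟩))

theorem viewModel_satisfies_of_lt {c : ℕ} {M : Instance} {r : TGD}
    (hc : ∀ a, a ∈ r.1 ∨ a ∈ r.2 → a.1 < c) (h : Satisfies M r) :
    Satisfies (viewModel c M) r := by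
  rw [satisfies_iff] at h ⊢
  intro θ hθ
  obtain ⟨η, h1, h2⟩ := h θ fun a ha =>
    (mem_viewModel_of_lt (a := a.rename θ) (hc a (Or.inl ha))).1 (hθ a ha)
  exact ⟨η, h1, fun a ha =>
    (mem_viewModel_of_lt (a := a.rename η) (hc a (Or.inr ha))).2 (h2 a ha)⟩

theorem viewModel_satisfies_bagRules {M : Instance} (h : ∀ r ∈ S, Satisfies M r) {w : ℕ} {r : TGD}
    (hr : r ∈ bagRules (nameBound S Q) w S Q) : Satisfies (viewModel (nameBound S Q) M) r := by
  rcases mem_bagRules.1 hr with ⟨r, hrS, L, -, rfl⟩ | hr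
  · exact satisfies_collapse (viewModel_satisfies_of_lt
      (fun a ha => name_lt_nameBound (mem_inputAtoms.2 (Or.inl ⟨r, hrS, ha⟩))) (h r hrS)) L
  · exact viewModel_satisfies_viewRules (fun q hq a ha =>
      name_lt_nameBound (mem_inputAtoms.2 (Or.inr ⟨q, hq, ha⟩))) hr

/-- The sequent is applied to the valuation that is `θ` on the body variables and the head witness
elsewhere. Side atoms and conclusion use body variables only, so they see just `θ`. -/
theorem step_sound {M : Instance} {r : TGD} {F B : FinInstance} {a : Atom} (hr : Satisfies M r)
    (hB : ∀ b ∈ B, b ∈ r.2 ++ F) (hF : ∀ v ∈ lvars F, v ∈ lvars r.1)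
    (ha : ∀ v ∈ a.2, v ∈ lvars r.1) (hs : SeqHolds M (B, a)) {θ : Var → Var}
    (h : ∀ b ∈ r.1 ++ F, b.rename θ ∈ M) : a.rename θ ∈ M := by
  obtain ⟨η, h1, h2⟩ := satisfies_iff.1 hr θ fun b hb => h b (List.mem_append_left _ hb)
  have := hs (fun v => if v ∈ lvars r.1 then θ v else η v) fun b hb => by
    rcases List.mem_append.1 (hB b hb) with hb | hb
    · convert h2 b hb using 1
      refine rename_congr fun v hv => ?_
      split_ifs with hv'
      · exact (h1 v hv' (mem_lvars.2 ⟨b, hb, hv⟩)).symm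
      · rfl
    · convert h b (List.mem_append_right _ hb) using 1
      exact rename_congr fun v hv => if_pos (hF v (mem_lvars.2 ⟨b, hb, hv⟩))
  convert this using 1
  exact rename_congr fun v hv => (if_pos (ha v hv)).symm

/-- Steps mention only input and view predicates apart from the sequent, so adding sequents and the
goal does not disturb the truth of a step. -/
theorem mem_auxModel_of_bag {M : Instance} {g : Prop} {a : Atom} {θ : Var → Var} {w : ℕ}
    (ha : a.pred ∈ bagPreds (nameBound S Q) w S Q) :
    a.rename θ ∈ auxModel (nameBound S Q) M g ↔ a.rename θ ∈ viewModel (nameBound S Q) M := by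
  apply mem_auxModel_of_not_aux
  · intro p
    rcases mem_bagPreds.1 ha with ⟨b, hb, h⟩ | ⟨s, -, h⟩
    · have hb' := name_lt_nameBound hb
      have : b.1 = a.1 := (congrArg Prod.fst h :)
      exact ((this ▸ hb').trans_le (le_seqAtom _ p)).ne
    · have : (viewAtom _ s).1 = a.1 := (congrArg Prod.fst h :)
      rw [rename_fst, ← this]
      exact viewAtom_ne_seqAtom
  · rcases mem_bagPreds.1 ha with ⟨b, hb, h⟩ | ⟨s, -, h⟩
    · have hb' := name_lt_nameBound hb
      have : b.1 = a.1 := (congrArg Prod.fst h :)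
      exact ((this ▸ hb').trans_le (le_goalAtom _)).ne
    · have : (viewAtom _ s).1 = a.1 := (congrArg Prod.fst h :)
      rw [rename_fst, ← this]
      exact viewAtom_ne_goalAtom

theorem pred_mem_bagPreds {w : ℕ} {r : TGD} (hr : r ∈ bagRules (nameBound S Q) w S Q) {a : Atom}
    (ha : a ∈ r.1 ∨ a ∈ r.2) : a.pred ∈ bagPreds (nameBound S Q) w S Q := by
  rcases mem_bagRules.1 hr with ⟨r', hr', L, -, rfl⟩ | hr
  · have : ∃ b, (b ∈ r'.1 ∨ b ∈ r'.2) ∧ b.rename (bodyFun r'.1 L) = a := by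
      rcases ha with ha | ha <;> obtain ⟨b, hb, rfl⟩ := List.mem_map.1 ha
      exacts [⟨b, Or.inl hb, rfl⟩, ⟨b, Or.inr hb, rfl⟩]
    obtain ⟨b, hb, rfl⟩ := this
    exact mem_bagPreds.2 (Or.inl ⟨b, mem_inputAtoms.2 (Or.inl ⟨r', hr', hb⟩), by simp⟩)
  · rcases mem_viewRules.1 hr with ⟨p, hp, -, rfl⟩ | ⟨p, hp, p', hp', s, hs, -, rfl⟩
    · rcases ha with ha | ha
      · exact mem_bagPreds.2 (Or.inl ⟨a, mem_inputAtoms_of_subquery hp ha, rfl⟩)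
      · exact mem_bagPreds.2 (Or.inr ⟨p, hp, by rw [List.mem_singleton.1 ha]⟩)
    · rcases ha with ha | ha
      · rcases List.mem_pair.1 ha with rfl | rfl
        exacts [mem_bagPreds.2 (Or.inr ⟨p, hp, rfl⟩), mem_bagPreds.2 (Or.inr ⟨p', hp', rfl⟩)]
      · exact mem_bagPreds.2 (Or.inr ⟨s, hs, by rw [List.mem_singleton.1 ha]⟩)

theorem auxModel_satisfies_program {M : Instance} {g : Prop} (h : ∀ r ∈ S, Satisfies M r)
    (hg : ∀ q ∈ Q, Entails M q.toInstance → g) {r : TGD} (hr : r ∈ program S Q) :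
    Satisfies (auxModel (nameBound S Q) M g) r := by
  rw [satisfies_iff]
  intro θ hθ
  -- The rules have no existential variables, so the body valuation also serves for the head.
  refine ⟨θ, fun _ _ _ => rfl, ?_⟩
  rcases mem_program.1 hr with ⟨q, hq, rfl⟩ | ⟨B, a, hB, ha, rfl⟩ | ⟨⟨r, F, B, a⟩, ht, rfl⟩ |
    ⟨⟨r, F, B, a⟩, ht, B', hB', L, -, rfl⟩
  · refine List.forall_mem_singleton.2 (goalAtom_mem_auxModel.2 ?_)
    have h1 : (viewAtom (nameBound S Q) (q, [])).rename θ ∈ viewModel (nameBound S Q) M :=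
      (mem_auxModel_of_not_aux (fun p => viewAtom_ne_seqAtom) viewAtom_ne_goalAtom).1
        (hθ _ (List.mem_singleton_self _))
    obtain ⟨ρ, -, h2⟩ := viewAtom_mem_viewModel.1 h1
    exact hg q hq ⟨ρ, rename_subset_iff.2 h2⟩
  · exact List.forall_mem_singleton.2 (seqAtom_mem_auxModel.2 fun θ h => h a ha)
  · refine List.forall_mem_singleton.2 ?_
    obtain ⟨⟨h1, h2, h3, h4⟩, h5, h6, h7⟩ := mem_steps.1 ht
    have hs : SeqHolds (viewModel (nameBound S Q) M) (B, a) :=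
      seqAtom_mem_auxModel.1 (hθ (seqAtom (nameBound S Q) (B, a)) (by simp [stepRule]))
    refine (mem_auxModel_of_bag (mem_bagAtoms.1 h4).1).2
      (step_sound (viewModel_satisfies_bagRules h h1) h5 h6 h7 hs fun b hb => ?_)
    refine (mem_auxModel_of_bag (w := varBound S Q) ?_).1
      (hθ b (List.mem_append_left _ hb))
    rcases List.mem_append.1 hb with hb | hb
    · exact pred_mem_bagPreds h1 (Or.inl hb)
    · exact (mem_bagAtoms.1 (h2.subset hb)).1
  · refine List.forall_mem_singleton.2 ?_
    obtain ⟨⟨h1, h2, h3, h4⟩, h5, h6, h7⟩ := mem_steps.1 ht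
    have hs : SeqHolds (viewModel (nameBound S Q) M) (B, a) :=
      seqAtom_mem_auxModel.1 (hθ (seqAtom (nameBound S Q) (B, a)) (by simp [bagStepRule]))
    refine seqAtom_mem_auxModel.2 fun θ' hθ' => ?_
    rw [rename_rename]
    refine step_sound (viewModel_satisfies_bagRules h h1) h5 h6 h7 hs fun b hb => ?_
    rw [← rename_rename]
    exact seqAtom_mem_auxModel.1 (hθ (seqAtom (nameBound S Q) (B', b.rename (listFun L)))
      (List.mem_append_left _ (List.mem_map.2 ⟨b, hb, rfl⟩))) θ' hθ'

theorem entailsSome_singleton {M D : Instance} : EntailsSome M {D} ↔ Entails M D := by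
  simp [EntailsSome]

theorem entails_goal {M : Instance} {c : ℕ} :
    Entails M (FinInstance.toInstance [goalAtom c]) ↔ goalAtom c ∈ M := by
  simp [Entails, rename_subset_iff]

theorem certain_of_certain_program {D : Instance} (hD : Disjoint {p | p ∈ auxPreds S Q} (preds D))
    (h : Certain {D} {r | r ∈ program S Q}
      {FinInstance.toInstance [goalAtom (nameBound S Q)]}) :
    Certain {D} {r | r ∈ S} {I | ∃ J ∈ Q, FinInstance.toInstance J = I} := by
  intro M hM hS
  set g : Prop := EntailsSome M {I | ∃ J ∈ Q, FinInstance.toInstance J = I}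
  set N : Instance := auxModel (nameBound S Q) M g with hN
  have hsat : ∀ r ∈ program S Q, Satisfies N r := fun r hr =>
    auxModel_satisfies_program hS (fun q hq hq' => ⟨_, ⟨q, hq, rfl⟩, hq'⟩) hr
  -- `D` may use names above `nameBound` that are not auxiliary, and `M` may contain auxiliary
  -- predicates. Hence `M` is kept exactly on the non-auxiliary predicates and the intended meaning
  -- overrides it on the others.
  set M' : Instance := {a | a.pred ∉ auxPreds S Q ∧ a ∈ M ∨ a.pred ∈ auxPreds S Q ∧ a ∈ N}
  have key : ∀ r ∈ program S Q, ∀ a, a ∈ r.1 ∨ a ∈ r.2 → ∀ θ : Var → Var,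
      (a.rename θ ∈ M' ↔ a.rename θ ∈ N) := by
    intro r hr a ha θ
    have h1 : a.pred ∈ auxPreds S Q ↔ nameBound S Q ≤ a.1 := by
      rw [mem_auxPreds]
      exact ⟨fun h => h.2, fun h => ⟨Or.inr ⟨r, hr, a, ha, rfl⟩, h⟩⟩
    simp only [M', Set.mem_ofPred_eq, rename_pred, h1]
    by_cases h2 : nameBound S Q ≤ a.1
    · simp [h2]
    · simp only [h2, not_false_eq_true, true_and, false_and, or_false]
      exact (mem_auxModel_of_lt (a := a.rename θ) (not_le.1 h2)).symm
  have hM' : EntailsSome M' {FinInstance.toInstance [goalAtom (nameBound S Q)]} := by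
    refine h M' ?_ fun r hr => satisfies_iff.2 fun θ hθ => ?_
    · rw [entailsSome_singleton] at hM ⊢
      obtain ⟨θ, hθ⟩ := hM
      refine ⟨θ, ?_⟩
      rintro _ ⟨a, ha, rfl⟩
      refine Or.inl ⟨fun h => ?_, hθ ⟨a, ha, rfl⟩⟩
      rw [rename_pred] at h
      exact Set.disjoint_left.1 hD h ⟨a, ha, rfl⟩
    · obtain ⟨η, h1, h2⟩ := satisfies_iff.1 (hsat r hr) θ fun a ha =>
        (key r hr a (Or.inl ha) θ).1 (hθ a ha)
      exact ⟨η, h1, fun a ha => (key r hr a (Or.inr ha) η).2 (h2 a ha)⟩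
  rw [entailsSome_singleton, entails_goal] at hM'
  rcases hM' with h1 | h1
  · exact absurd (mem_auxPreds.2 ⟨Or.inl rfl, le_goalAtom _⟩) h1.1
  · exact goalAtom_mem_auxModel.1 h1.2

end Input

/-! ### Atoms over arbitrary elements -/

/-- Application of a map to the arguments of an atom. -/
def mapAtom {X Y : Type*} (f : X → Y) (a : ℕ × List X) : ℕ × List Y := (a.1, a.2.map f)

section MapAtom

variable {X Y Z : Type*}

theorem mapAtom_mapAtom (f : X → Y) (g : Y → Z) (a : ℕ × List X) :
    mapAtom g (mapAtom f a) = mapAtom (fun x => g (f x)) a := by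
  simp [mapAtom, Function.comp_def]

theorem mapAtom_congr {f g : X → Y} {a : ℕ × List X} (h : ∀ x ∈ a.2, f x = g x) :
    mapAtom f a = mapAtom g a :=
  Prod.ext rfl (List.map_congr_left h)

theorem mapAtom_injective {f : X → Y} (hf : f.Injective) : (mapAtom f).Injective := fun _ _ h =>
  Prod.ext (congrArg Prod.fst h :) (hf.list_map (congrArg Prod.snd h :))

theorem exists_of_mapAtom_eq {X' : Type*} {f : X → Y} {g : X' → Y} {a : ℕ × List X}
    {b : ℕ × List X'} (h : mapAtom f a = mapAtom g b) {x : X} (hx : x ∈ a.2) :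
    ∃ y ∈ b.2, g y = f x := by
  have h2 : a.2.map f = b.2.map g := congrArg Prod.snd h
  exact List.mem_map.1 (h2 ▸ List.mem_map_of_mem hx)

/-- The lift is chosen pointwise, so a single `h'` serves all atoms that can be pulled back; its
values at other variables are irrelevant. -/
theorem exists_lift [Nonempty X] {f : X → Y} (hf : f.Injective) (h : Var → Y) :
    ∃ h' : Var → X, ∀ (a : Atom) (b : ℕ × List X), mapAtom h a = mapAtom f b →
      b = mapAtom h' a ∧ ∀ v ∈ a.2, f (h' v) = h v := by
  refine ⟨fun v => Function.invFun f (h v), fun a b hab => ?_⟩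
  have h1 : ∀ v ∈ a.2, f (Function.invFun f (h v)) = h v := fun v hv => by
    obtain ⟨y, -, hy⟩ := exists_of_mapAtom_eq hab hv
    exact Function.invFun_eq ⟨y, hy⟩
  refine ⟨mapAtom_injective hf ?_, h1⟩
  rw [← hab, mapAtom_mapAtom]
  exact mapAtom_congr fun v hv => (h1 v hv).symm

end MapAtom

/-! ### Tree-like models -/

/-- A tgd with a valuation of its body, as a list. -/
abbrev Trigger := TGD × List Var

/-- An element of a tree-like model: a path of triggers and a variable of the bag reached. -/
abbrev Elem := List Trigger × Var

/-- The element of the root bag given by a variable. -/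
def rootElem (v : Var) : Elem := ([], v)

/-- The inclusion of the subtree at the child `t`. -/
def incl (t : Trigger) (e : Elem) : Elem :=
  if e.1 = [] ∧ e.2 ∈ lvars t.1.1 then ([], listFun t.2 e.2) else (t :: e.1, e.2)

theorem rootElem_injective : rootElem.Injective := fun _ _ h => (Prod.ext_iff.1 h).2

theorem incl_rootElem {t : Trigger} {v : Var} (h : v ∈ lvars t.1.1) :
    incl t (rootElem v) = rootElem (listFun t.2 v) := by
  simp [incl, rootElem, h]

theorem eq_of_incl_root {t : Trigger} {e : Elem} (h : (incl t e).1 = []) :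
    e = rootElem e.2 ∧ e.2 ∈ lvars t.1.1 := by
  unfold incl at h
  split_ifs at h with h'
  exact ⟨Prod.ext h'.1 rfl, h'.2⟩

/-- Body variables go to the root bag, all other elements to paths starting with `t`. Injectivity of
the trigger valuation is all that remains; this is why tgds are collapsed before they fire. -/
theorem incl_injective {t : Trigger} (h : Set.InjOn (listFun t.2) {v | v ∈ lvars t.1.1}) :
    (incl t).Injective := by
  intro e e' he
  unfold incl at he
  split_ifs at he with h1 h2 h2
  · exact Prod.ext (h1.1.trans h2.1.symm) (h h1.2 h2.2 (Prod.ext_iff.1 he).2)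
  · simp at he
  · simp at he
  · simp only [Prod.mk.injEq, List.cons.injEq, true_and] at he
    exact Prod.ext he.1 he.2

/-- Different subtrees overlap only in the root bag. -/
theorem root_of_incl_eq {t t' : Trigger} (h : t ≠ t') {e e' : Elem} (he : incl t e = incl t' e') :
    (incl t e).1 = [] := by
  unfold incl at he ⊢
  split_ifs at he ⊢ with h1 h2
  · rfl
  · rfl
  · simp at he
  · exact absurd (List.cons.inj (congrArg Prod.fst he :)).1 h

theorem lift_of_incl_root {t : Trigger} {a : Atom} {b : ℕ × List Elem}
    (h : mapAtom rootElem a = mapAtom (incl t) b) :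
    ∃ a' : Atom, b = mapAtom rootElem a' ∧ (∀ v ∈ a'.2, v ∈ lvars t.1.1) ∧
      a = a'.rename (listFun t.2) := by
  have h1 : ∀ e ∈ b.2, e = rootElem e.2 ∧ e.2 ∈ lvars t.1.1 := fun e he => by
    obtain ⟨v, -, hv⟩ := exists_of_mapAtom_eq h.symm he
    exact eq_of_incl_root (by rw [← hv]; rfl)
  have h2 : b = mapAtom rootElem (mapAtom Prod.snd b) := by
    rw [mapAtom_mapAtom]
    exact Prod.ext rfl ((List.map_id _).symm.trans (List.map_congr_left fun e he => (h1 e he).1))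
  have h3 : ∀ v ∈ (mapAtom Prod.snd b).2, v ∈ lvars t.1.1 := fun v hv => by
    obtain ⟨e, he, rfl⟩ := List.mem_map.1 hv
    exact (h1 e he).2
  refine ⟨mapAtom Prod.snd b, h2, h3, mapAtom_injective rootElem_injective ?_⟩
  calc mapAtom rootElem a = mapAtom (incl t) (mapAtom rootElem (mapAtom Prod.snd b)) := by
        rw [h, ← h2]
    _ = mapAtom (fun v => rootElem (listFun t.2 v)) (mapAtom Prod.snd b) := by
        rw [mapAtom_mapAtom]
        exact mapAtom_congr fun v hv => incl_rootElem (h3 v hv)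
    _ = mapAtom rootElem (Atom.rename (listFun t.2) (mapAtom Prod.snd b)) :=
        (mapAtom_mapAtom _ _ _).symm

section Model

variable {S : List TGD} {Q : List FinInstance}

theorem mem_bagAtoms_of_bagRules {r : TGD} (hr : r ∈ bagRules (nameBound S Q) (varBound S Q) S Q)
    {a : Atom} (ha : a ∈ r.1 ∨ a ∈ r.2) : a ∈ bagAtoms S Q := by
  refine mem_bagAtoms.2 ⟨pred_mem_bagPreds hr ha, ?_⟩
  rcases mem_bagRules.1 hr with ⟨r', hr', L, -, rfl⟩ | hr
  · have : ∃ b, (b ∈ r'.1 ∨ b ∈ r'.2) ∧ b.rename (bodyFun r'.1 L) = a := by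
      rcases ha with ha | ha <;> obtain ⟨b, hb, rfl⟩ := List.mem_map.1 ha
      exacts [⟨b, Or.inl hb, rfl⟩, ⟨b, Or.inr hb, rfl⟩]
    obtain ⟨b, hb, rfl⟩ := this
    intro v hv
    obtain ⟨u, hu, rfl⟩ := List.mem_map.1 hv
    by_cases hu' : u ∈ lvars r'.1
    · obtain ⟨a, ha, hv⟩ := mem_lvars.1 (bodyFun_mem (L := L) hu')
      exact var_lt_varBound (mem_inputAtoms.2 (Or.inl ⟨r', hr', Or.inl ha⟩)) hv
    · rw [bodyFun_of_not_mem hu']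
      exact var_lt_varBound (mem_inputAtoms.2 (Or.inl ⟨r', hr', hb⟩)) hu
  · have h : ∀ p ∈ views (varBound S Q) Q, ∀ v ∈ p.2, v < varBound S Q := fun p hp v hv =>
      List.mem_range.1 ((mem_views.1 hp).2.subset hv)
    rcases mem_viewRules.1 hr with ⟨p, hp, -, rfl⟩ | ⟨p, hp, p', hp', s, hs, -, rfl⟩
    · rcases ha with ha | ha
      · exact fun v => var_lt_varBound (mem_inputAtoms_of_subquery (S := S) hp ha)
      · rw [List.mem_singleton.1 ha]
        exact h p hp
    · rcases ha with ha | ha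
      · rcases List.mem_pair.1 ha with rfl | rfl
        exacts [h p hp, h p' hp']
      · rw [List.mem_singleton.1 ha]
        exact h s hs

variable (S Q) in
/-- `T` is closed under the derivation steps whose sequent is in `R`. -/
def IsClosed (R : Set (FinInstance × Atom)) (T : Instance) : Prop :=
  ∀ r F B a, (r, F, B, a) ∈ inputSteps S Q → (B, a) ∈ R → ∀ ρ : Var → Var,
    (∀ b ∈ r.1 ++ F, b.rename ρ ∈ T) → a.rename ρ ∈ T

variable (S Q) in
/-- A set of sequents is saturated if it contains the trivial ones and is closed under the
derivation steps. -/
structure IsSaturated (R : Set (FinInstance × Atom)) : Prop where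
  /-- Trivial sequents. -/
  mem_of_mem : ∀ B : FinInstance, B.Sublist (bagAtoms S Q) → ∀ a ∈ B, (B, a) ∈ R
  /-- Closure under steps. -/
  closed : ∀ B : FinInstance, B.Sublist (bagAtoms S Q) →
    IsClosed S Q R {a | a ∈ bagAtoms S Q ∧ (B, a) ∈ R}

variable (S Q) in
open Classical in
/-- The atoms with which the child `t` of the bag `T` starts. -/
noncomputable def childBag (T : Instance) (t : Trigger) : FinInstance :=
  (bagAtoms S Q).filter fun a =>
    a ∈ t.1.2 ∨ (∀ v ∈ a.2, v ∈ lvars t.1.1) ∧ a.rename (listFun t.2) ∈ T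

variable (S Q) in
/-- The child `t` of the bag `T`. -/
def child (R : Set (FinInstance × Atom)) (T : Instance) (t : Trigger) : Instance :=
  {a | a ∈ bagAtoms S Q ∧ (childBag S Q T t, a) ∈ R}

variable (S Q) in
/-- The bag `T` has a child `t`. -/
structure Fires (T : Instance) (t : Trigger) : Prop where
  /-- The tgd is a bag rule. -/
  rule : t.1 ∈ bagRules (nameBound S Q) (varBound S Q) S Q
  /-- The body holds. -/
  body : ∀ a ∈ t.1.1, a.rename (listFun t.2) ∈ T
  /-- The valuation is injective on the body variables. -/
  inj : Set.InjOn (listFun t.2) {v | v ∈ lvars t.1.1}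

variable (S Q) in
/-- The atoms of the tree-like model with root bag `T` in bags of depth at most `n`. -/
def treeModel (R : Set (FinInstance × Atom)) : ℕ → Instance → Set (ℕ × List Elem)
  | 0, T => mapAtom rootElem '' T
  | n + 1, T => mapAtom rootElem '' T ∪
      {x | ∃ t b, Fires S Q T t ∧ b ∈ treeModel R n (child S Q R T t) ∧ x = mapAtom (incl t) b}

/-! ### Exchange of atoms between a bag and its children -/

variable {R : Set (FinInstance × Atom)} {T : Instance} {t : Trigger}

theorem root_mem_treeModel {a : Atom} (h : a ∈ T) (n : ℕ) :
    mapAtom rootElem a ∈ treeModel S Q R n T := by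
  cases n with
  | zero => exact ⟨a, h, rfl⟩
  | succ n => exact Or.inl ⟨a, h, rfl⟩

theorem treeModel_cases {n : ℕ} {x : ℕ × List Elem} (h : x ∈ treeModel S Q R n T) :
    (∃ a ∈ T, x = mapAtom rootElem a) ∨ ∃ m t b, n = m + 1 ∧ Fires S Q T t ∧
      b ∈ treeModel S Q R m (child S Q R T t) ∧ x = mapAtom (incl t) b := by
  cases n with
  | zero =>
    obtain ⟨a, ha, rfl⟩ := h
    exact Or.inl ⟨a, ha, rfl⟩
  | succ n =>
    rcases h with ⟨a, ha, rfl⟩ | ⟨t, b, h⟩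
    · exact Or.inl ⟨a, ha, rfl⟩
    · exact Or.inr ⟨n, t, b, rfl, h⟩

theorem treeModel_succ {n : ℕ} {x : ℕ × List Elem} (h : x ∈ treeModel S Q R n T) :
    x ∈ treeModel S Q R (n + 1) T := by
  induction n generalizing T x with
  | zero => exact Or.inl h
  | succ n ih =>
    rcases h with h | ⟨t, b, h1, h2, rfl⟩
    · exact Or.inl h
    · exact Or.inr ⟨t, b, h1, ih h2, rfl⟩

theorem treeModel_mono {T : Instance} : Monotone fun n => treeModel S Q R n T :=
  monotone_nat_of_le_succ fun _ _ h => treeModel_succ h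

theorem childBag_sublist : (childBag S Q T t).Sublist (bagAtoms S Q) := List.filter_sublist

theorem IsSaturated.isClosed_child (hR : IsSaturated S Q R) : IsClosed S Q R (child S Q R T t) :=
  hR.closed _ childBag_sublist

theorem mem_childBag {a : Atom} : a ∈ childBag S Q T t ↔ a ∈ bagAtoms S Q ∧
    (a ∈ t.1.2 ∨ (∀ v ∈ a.2, v ∈ lvars t.1.1) ∧ a.rename (listFun t.2) ∈ T) := by
  simp only [childBag, List.mem_filter, decide_eq_true_eq]

theorem IsSaturated.mem_child (hR : IsSaturated S Q R) {a : Atom} (h : a ∈ childBag S Q T t) :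
    a ∈ child S Q R T t :=
  ⟨childBag_sublist.subset h, hR.mem_of_mem _ childBag_sublist a h⟩

/-- This is the purpose of steps. The side atoms are taken to be all bag atoms over the body
variables that hold in `T`; with the head they cover `childBag`, whose sequent for `a` is in `R` by
definition of the child. -/
theorem IsClosed.of_child (hT : IsClosed S Q R T) (ht : Fires S Q T t) {a : Atom}
    (ha : a ∈ child S Q R T t) (hv : ∀ v ∈ a.2, v ∈ lvars t.1.1) :
    a.rename (listFun t.2) ∈ T := by
  classical
  have hF : ∀ {b}, b ∈ (bagAtoms S Q).filter (fun a =>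
      (∀ v ∈ a.2, v ∈ lvars t.1.1) ∧ a.rename (listFun t.2) ∈ T) ↔
      b ∈ bagAtoms S Q ∧ (∀ v ∈ b.2, v ∈ lvars t.1.1) ∧ b.rename (listFun t.2) ∈ T := by
    intro b
    simp only [List.mem_filter, decide_eq_true_eq]
  refine hT t.1 ((bagAtoms S Q).filter fun a =>
      (∀ v ∈ a.2, v ∈ lvars t.1.1) ∧ a.rename (listFun t.2) ∈ T) (childBag S Q T t) a
    (mem_steps.2 ⟨⟨ht.rule, List.filter_sublist, childBag_sublist, ha.1⟩, ?_, ?_, hv⟩) ha.2 _ ?_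
  · intro b hb
    rw [List.mem_append, hF]
    rcases mem_childBag.1 hb with ⟨h1, h2 | h2⟩
    exacts [Or.inl h2, Or.inr ⟨h1, h2⟩]
  · intro v hv
    obtain ⟨b, hb, hv⟩ := mem_lvars.1 hv
    exact (hF.1 hb).2.1 v hv
  · intro b hb
    rcases List.mem_append.1 hb with hb | hb
    exacts [ht.body b hb, (hF.1 hb).2.2]

/-- A full rule is a step without side atoms whose sequent `([a], a)` is trivial. -/
theorem IsClosed.of_rule (hR : IsSaturated S Q R) (hT : IsClosed S Q R T) {B : FinInstance}
    {a : Atom} (hr : (B, [a]) ∈ bagRules (nameBound S Q) (varBound S Q) S Q)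
    (ha : ∀ v ∈ a.2, v ∈ lvars B) {ρ : Var → Var} (h : ∀ b ∈ B, b.rename ρ ∈ T) :
    a.rename ρ ∈ T := by
  have hA : a ∈ bagAtoms S Q := mem_bagAtoms_of_bagRules hr (Or.inr (List.mem_singleton_self a))
  have hs : [a].Sublist (bagAtoms S Q) := List.singleton_sublist.2 hA
  refine hT (B, [a]) [] [a] a (mem_steps.2 ⟨⟨hr, List.nil_sublist _, hs, hA⟩, ?_, ?_, ha⟩)
    (hR.mem_of_mem _ hs a (List.mem_singleton_self a)) ρ ?_
  · simp
  · simp [lvars]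
  · simpa using h

/-- An atom over root elements found deep in the tree is handed up one level at a time by
`IsClosed.of_child`. -/
theorem IsClosed.mem_of_root (hR : IsSaturated S Q R) (hT : IsClosed S Q R T) {n : ℕ} {a : Atom}
    (h : mapAtom rootElem a ∈ treeModel S Q R n T) : a ∈ T := by
  induction n generalizing T a with
  | zero =>
    obtain ⟨a', ha', h⟩ := h
    rwa [← mapAtom_injective rootElem_injective h]
  | succ n ih =>
    rcases h with ⟨a', ha', h⟩ | ⟨t, b, ht, hb, h⟩
    · rwa [← mapAtom_injective rootElem_injective h]
    · obtain ⟨a', rfl, hv, rfl⟩ := lift_of_incl_root h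
      exact hT.of_child ht (ih hR.isClosed_child hb) hv

theorem mem_child_of_root (hR : IsSaturated S Q R) (ht : Fires S Q T t) {a : Atom} (ha : a ∈ T)
    (hp : a.pred ∈ bagPreds (nameBound S Q) (varBound S Q) S Q) {b : ℕ × List Elem}
    (h : mapAtom rootElem a = mapAtom (incl t) b) (n : ℕ) :
    b ∈ treeModel S Q R n (child S Q R T t) := by
  obtain ⟨a', rfl, hv, rfl⟩ := lift_of_incl_root h
  refine root_mem_treeModel (hR.mem_child (mem_childBag.2 ⟨mem_bagAtoms.2 ⟨?_, ?_⟩,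
    Or.inr ⟨hv, ha⟩⟩)) n
  · rwa [rename_pred] at hp
  · intro v h
    obtain ⟨b, hb, hv⟩ := mem_lvars.1 (hv v h)
    exact (mem_bagAtoms.1 (mem_bagAtoms_of_bagRules ht.rule (Or.inl hb))).2 v hv

/-- An atom over elements of the subtree at `t` may have been found in the root bag or in a sibling
subtree. In the sibling case it lies over root elements, hence in `T`; either way the child inherits
it through `childBag`. The depth may change. The condition on the predicate is needed because the
root bag can contain atoms that children do not inherit. -/
theorem mem_child_of_incl (hR : IsSaturated S Q R) (hT : IsClosed S Q R T) (ht : Fires S Q T t)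
    {b : ℕ × List Elem} (hp : (b.1, b.2.length) ∈ bagPreds (nameBound S Q) (varBound S Q) S Q)
    {n : ℕ} (h : mapAtom (incl t) b ∈ treeModel S Q R n T) :
    ∃ m, b ∈ treeModel S Q R m (child S Q R T t) := by
  have key : ∀ a : Atom, a ∈ T → mapAtom (incl t) b = mapAtom rootElem a →
      ∃ m, b ∈ treeModel S Q R m (child S Q R T t) := by
    intro a ha h
    refine ⟨0, mem_child_of_root hR ht ha ?_ h.symm 0⟩
    have h1 : b.1 = a.1 := congrArg Prod.fst h
    have h2 : b.2.map (incl t) = a.2.map rootElem := congrArg Prod.snd h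
    have h3 := congrArg List.length h2
    rw [List.length_map, List.length_map] at h3
    rwa [Atom.pred, ← h1, ← h3]
  rcases treeModel_cases h with ⟨a, ha, h⟩ | ⟨m, t', b', -, ht', hb', h'⟩
  · exact key a ha h
  · by_cases htt : t = t'
    · subst htt
      rw [mapAtom_injective (incl_injective ht.inj) h']
      exact ⟨m, hb'⟩
    · have h1 : mapAtom (incl t) b = mapAtom rootElem (mapAtom Prod.snd (mapAtom (incl t) b)) := by
        rw [mapAtom_mapAtom, mapAtom_mapAtom]
        refine mapAtom_congr fun e he => Prod.ext ?_ rfl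
        obtain ⟨e', -, he'⟩ := exists_of_mapAtom_eq h' he
        exact root_of_incl_eq htt he'.symm
      exact key _ (hT.mem_of_root hR (h1 ▸ h)) h1

theorem exists_head_of_root (hR : IsSaturated S Q R) {r : TGD} (hr : r ∈ S) {θ : Var → Var}
    (hθ : ∀ a ∈ r.1, a.rename θ ∈ T) : ∃ η : Var → Elem,
      (∀ v ∈ lvars r.1, η v = rootElem (θ v)) ∧ ∀ a ∈ r.2, mapAtom η a ∈ treeModel S Q R 1 T := by
  set w := varBound S Q with hw
  have hlt : ∀ v ∈ lvars r.1, v < w := fun v hv => by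
    obtain ⟨a, ha, hv⟩ := mem_lvars.1 hv
    exact var_lt_varBound (mem_inputAtoms.2 (Or.inl ⟨r, hr, Or.inl ha⟩)) hv
  have hlist : ∀ (f : Var → Var), ∀ v ∈ lvars r.1, listFun ((List.range w).map f) v = f v := by
    intro f v hv
    simp [listFun, hlt v hv]
  -- One representative body variable is chosen in each fibre of `θ`; collapsing along `g` makes the
  -- valuation injective.
  set g : Var → Var := fun v =>
    if v ∈ lvars r.1 then Function.invFunOn θ {v | v ∈ lvars r.1} (θ v) else v with hg
  have hg1 : ∀ v ∈ lvars r.1, g v ∈ lvars r.1 ∧ θ (g v) = θ v := fun v hv => by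
    simp only [hg, hv, if_true]
    exact Function.invFunOn_pos (s := {v | v ∈ lvars r.1}) ⟨v, hv, rfl⟩
  have hg2 : ∀ u ∈ lvars r.1, ∀ v ∈ lvars r.1, θ u = θ v → g u = g v := fun u hu v hv h => by
    simp only [hg, hu, hv, if_true, h]
  set L := (List.range w).map g
  have hL : L ∈ tuples (List.range w) w := by
    refine mem_tuples.2 ⟨by simp [L], fun x hx => ?_⟩
    obtain ⟨v, hv, rfl⟩ := List.mem_map.1 hx
    by_cases hv' : v ∈ lvars r.1
    · exact List.mem_range.2 (hlt _ (hg1 v hv').1)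
    · simpa [hg, hv'] using hv
  have hb : ∀ v ∈ lvars r.1, bodyFun r.1 L v = g v := fun v hv => by
    have : listFun L v = g v := hlist g v hv
    rw [bodyFun, this, if_pos ⟨hv, (hg1 v hv).1⟩]
  -- Only values at variables below `w` matter, so a list stores the valuation and elements of the
  -- tree stay encodable.
  set t : Trigger := (collapse r L, (List.range w).map θ)
  have hlv : ∀ v, v ∈ lvars t.1.1 ↔ ∃ u ∈ lvars r.1, g u = v := fun v => by
    refine mem_lvars_map_rename.trans (exists_congr fun u => and_congr_right fun hu => ?_)
    rw [hb u hu]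
  have htθ : ∀ u ∈ lvars r.1, listFun t.2 (g u) = θ u := fun u hu =>
    (hlist θ _ (hg1 u hu).1).trans (hg1 u hu).2
  have ht : Fires S Q T t := by
    refine ⟨mem_bagRules.2 (Or.inl ⟨r, hr, L, hL, rfl⟩), fun a ha => ?_, fun u hu v hv h => ?_⟩
    · obtain ⟨b, hb', rfl⟩ := List.mem_map.1 ha
      rw [rename_rename]
      convert hθ b hb' using 1
      refine rename_congr fun v hv => ?_
      have hv' := mem_lvars.2 ⟨b, hb', hv⟩
      rw [Function.comp_apply, hb v hv', htθ v hv']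
    · obtain ⟨u, hu', rfl⟩ := (hlv _).1 hu
      obtain ⟨v, hv', rfl⟩ := (hlv _).1 hv
      rw [htθ u hu', htθ v hv'] at h
      exact hg2 u hu' v hv' h
  refine ⟨fun v => incl t (rootElem (bodyFun r.1 L v)), fun v hv => ?_, fun a ha => ?_⟩
  · simp only [hb v hv]
    rw [incl_rootElem ((hlv _).2 ⟨v, hv, rfl⟩), htθ v hv]
  · have ha' : a.rename (bodyFun r.1 L) ∈ t.1.2 := List.mem_map_of_mem ha
    refine Or.inr ⟨t, mapAtom rootElem (a.rename (bodyFun r.1 L)), ht,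
      root_mem_treeModel (hR.mem_child (mem_childBag.2 ⟨?_, Or.inl ha'⟩)) 0, ?_⟩
    · exact mem_bagAtoms_of_bagRules ht.rule (Or.inr ha')
    · change _ = mapAtom _ (mapAtom _ (mapAtom _ _))
      rw [mapAtom_mapAtom, mapAtom_mapAtom]

/-- Induction on the depth of the guard atom alone. If it lies in the root bag, the whole body is
over root elements and thus in `T`. Otherwise the body lies over one subtree and `mem_child_of_incl`
moves it there; the other body atoms may have any depth. -/
theorem treeModel_satisfies (hR : IsSaturated S Q R) (hT : IsClosed S Q R T) {r : TGD}
    (hr : r ∈ S) {g : Atom} (hgv : ∀ v ∈ lvars r.1, v ∈ g.2) {n : ℕ}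
    {θ : Var → Elem} (hn : mapAtom θ g ∈ treeModel S Q R n T)
    (hθ : ∀ a ∈ r.1, ∃ m, mapAtom θ a ∈ treeModel S Q R m T) :
    ∃ η : Var → Elem, (∀ v ∈ lvars r.1, η v = θ v) ∧
      ∀ a ∈ r.2, ∃ m, mapAtom η a ∈ treeModel S Q R m T := by
  induction n using Nat.strong_induction_on generalizing T θ with
  | _ n ih =>
  rcases treeModel_cases hn with ⟨a, ha, h⟩ | ⟨m, t, b, rfl, ht, hb, h⟩
  · have h1 : ∀ v ∈ lvars r.1, rootElem (θ v).2 = θ v := fun v hv => by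
      obtain ⟨u, -, hu⟩ := exists_of_mapAtom_eq h (hgv v hv)
      rw [← hu]
      rfl
    obtain ⟨η, h2, h3⟩ := exists_head_of_root (T := T) (Q := Q) hR hr (θ := fun v => (θ v).2)
      fun a ha => by
        obtain ⟨m, hm⟩ := hθ a ha
        refine hT.mem_of_root hR (n := m) ?_
        change mapAtom rootElem (mapAtom _ _) ∈ _
        rw [mapAtom_mapAtom, mapAtom_congr fun v hv => h1 v (mem_lvars.2 ⟨a, ha, hv⟩)]
        exact hm
    exact ⟨η, fun v hv => (h2 v hv).trans (h1 v hv), fun a ha => ⟨1, h3 a ha⟩⟩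
  · obtain ⟨θ', hθ'⟩ := exists_lift (incl_injective ht.inj) θ
    obtain ⟨rfl, h1⟩ := hθ' g b h
    have h2 : ∀ v ∈ lvars r.1, incl t (θ' v) = θ v := fun v hv => h1 v (hgv v hv)
    obtain ⟨η, h3, h4⟩ := ih m m.lt_succ_self hR.isClosed_child hb fun a ha => by
      obtain ⟨k, hk⟩ := hθ a ha
      refine mem_child_of_incl hR hT ht (n := k) ?_ ?_
      · have : (a.1, (a.2.map θ').length) = a.pred := by simp [Atom.pred]
        rw [mapAtom, this]
        exact mem_bagPreds.2 (Or.inl ⟨a, mem_inputAtoms.2 (Or.inl ⟨r, hr, Or.inl ha⟩), rfl⟩)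
      · rwa [mapAtom_mapAtom, mapAtom_congr fun v hv => h2 v (mem_lvars.2 ⟨a, ha, hv⟩)]
    refine ⟨fun v => incl t (η v), fun v hv => ?_, fun a ha => ?_⟩
    · simp only [h3 v hv, h2 v hv]
    · obtain ⟨k, hk⟩ := h4 a ha
      exact ⟨k + 1, Or.inr ⟨t, _, ht, hk, (mapAtom_mapAtom _ _ _).symm⟩⟩

/-- Induction on the depth, then on the number of atoms. If some atom is not in the root bag, the
atoms in its subtree are split off: they form a view of smaller depth in the child, the others a
shorter view here, and a join rule combines the two. -/
theorem viewAtom_mem (hR : IsSaturated S Q R) {n : ℕ} (hT : IsClosed S Q R T)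
    {p : FinInstance × List Var} (hp : p ∈ views (varBound S Q) Q) {h : Var → Elem}
    (hn : ∀ a ∈ p.1, mapAtom h a ∈ treeModel S Q R n T)
    (hY : ∀ v ∈ p.2, v ∈ lvars p.1 ∧ (h v).1 = []) :
    (viewAtom (nameBound S Q) p).rename (fun v => (h v).2) ∈ T := by
  classical
  induction n using Nat.strong_induction_on generalizing T p h with
  | _ n ihn =>
  induction hl : p.1.length using Nat.strong_induction_on generalizing p with
  | _ l ihl =>
  by_cases hbase : ∀ a ∈ p.1, ∃ a' ∈ T, mapAtom h a = mapAtom rootElem a'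
  · refine hT.of_rule hR (B := p.1) (mem_bagRules.2 (Or.inr (mem_viewRules.2
      (Or.inl ⟨p, hp, fun v hv => (hY v hv).1, rfl⟩)))) (fun v hv => (hY v hv).1) fun a ha => ?_
    obtain ⟨a', ha', h1⟩ := hbase a ha
    have h2 := congrArg (mapAtom Prod.snd) h1
    rw [mapAtom_mapAtom, mapAtom_mapAtom] at h2
    have h3 : mapAtom (fun v => (rootElem v).2) a' = a' := Prod.ext rfl (List.map_id _)
    rw [h3] at h2
    change mapAtom _ a ∈ T
    rwa [h2]
  · push Not at hbase
    obtain ⟨a₀, ha₀, hroot⟩ := hbase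
    rcases treeModel_cases (hn a₀ ha₀) with ⟨a', ha', h'⟩ | ⟨m, t, b₀, rfl, ht, hb₀, h₀⟩
    · exact absurd h' (hroot a' ha')
    let P : Atom → Prop := fun a =>
      ∃ b ∈ treeModel S Q R m (child S Q R T t), mapAtom h a = mapAtom (incl t) b
    let q₁ := p.1.filter fun a => P a
    let q₂ := p.1.filter fun a => ¬ P a
    -- All variables at root elements become answer variables. Filtering the range yields a sublist
    -- of it, as `views` requires.
    let Y : FinInstance → List Var := fun q =>
      (List.range (varBound S Q)).filter fun v => v ∈ lvars q ∧ (h v).1 = []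
    have hq₁ : ∀ {a}, a ∈ q₁ ↔ a ∈ p.1 ∧ P a := by simp [q₁]
    have hq₂ : ∀ {a}, a ∈ q₂ ↔ a ∈ p.1 ∧ ¬ P a := by simp [q₂]
    have hY' : ∀ {q v}, v ∈ Y q ↔ v < varBound S Q ∧ v ∈ lvars q ∧ (h v).1 = [] := by simp [Y]
    obtain ⟨⟨q, hq, hpq⟩, hpY⟩ := mem_views.1 hp
    have hv₁ : (q₁, Y q₁) ∈ views (varBound S Q) Q :=
      mem_views.2 ⟨⟨q, hq, List.filter_sublist.trans hpq⟩, List.filter_sublist⟩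
    have hv₂ : (q₂, Y q₂) ∈ views (varBound S Q) Q :=
      mem_views.2 ⟨⟨q, hq, List.filter_sublist.trans hpq⟩, List.filter_sublist⟩
    have hlt : ∀ v ∈ lvars p.1, v < varBound S Q := fun v hv => by
      obtain ⟨a, ha, hv⟩ := mem_lvars.1 hv
      exact var_lt_varBound (mem_inputAtoms_of_subquery hp ha) hv
    have hu₁ : (viewAtom (nameBound S Q) (q₁, Y q₁)).rename (fun v => (h v).2) ∈ T := by
      obtain ⟨h', hh'⟩ := exists_lift (incl_injective ht.inj) h
      have e : ∀ v ∈ Y q₁, h' v = rootElem (h' v).2 ∧ (h' v).2 ∈ lvars t.1.1 ∧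
          listFun t.2 (h' v).2 = (h v).2 := fun v hv => by
        obtain ⟨-, hv1, hv2⟩ := hY'.1 hv
        obtain ⟨a, ha, hva⟩ := mem_lvars.1 hv1
        obtain ⟨b, hb, hab⟩ := (hq₁.1 ha).2
        have h1 := (hh' a b hab).2 v hva
        rw [← h1] at hv2
        obtain ⟨h2, h3⟩ := eq_of_incl_root hv2
        refine ⟨h2, h3, ?_⟩
        rw [h2, incl_rootElem h3] at h1
        rw [← h1]
        rfl
      have h1 := ihn m m.lt_succ_self hR.isClosed_child hv₁ (h := h') (fun a ha => by
        obtain ⟨b, hb, hab⟩ := (hq₁.1 ha).2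
        rwa [← (hh' a b hab).1]) fun v hv => ⟨(hY'.1 hv).2.1, by rw [(e v hv).1]; rfl⟩
      -- The arguments of the child's view atom are body variables of the trigger, so the atom can
      -- be returned to `T`.
      have h2 := hT.of_child ht h1 fun v hv => by
        obtain ⟨u, hu, rfl⟩ := List.mem_map.1 hv
        exact (e u hu).2.1
      rw [rename_rename] at h2
      convert h2 using 1
      exact rename_congr fun v hv => (e v hv).2.2.symm
    have hu₂ : (viewAtom (nameBound S Q) (q₂, Y q₂)).rename (fun v => (h v).2) ∈ T := by
      refine ihl _ ?_ hv₂ (fun a ha => hn a (hq₂.1 ha).1) (fun v hv => (hY'.1 hv).2) rfl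
      rw [← hl]
      -- The second part is strictly shorter because `a₀` was split off.
      refine lt_of_le_of_ne List.filter_sublist.length_le fun hlen => ?_
      have : q₂ = p.1 := List.filter_sublist.eq_of_length hlen
      exact (hq₂.1 (this.symm ▸ ha₀ : a₀ ∈ q₂)).2 ⟨b₀, hb₀, h₀⟩
    -- A shared variable lies both in the subtree at `t` and in the root bag or another subtree,
    -- hence at a root element.
    have hshare : ∀ v ∈ lvars q₁, v ∈ lvars q₂ → (h v).1 = [] := by
      intro v hv1 hv2
      obtain ⟨a₁, ha₁, hva₁⟩ := mem_lvars.1 hv1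
      obtain ⟨a₂, ha₂, hva₂⟩ := mem_lvars.1 hv2
      obtain ⟨b₁, hb₁, hab₁⟩ := (hq₁.1 ha₁).2
      obtain ⟨e₁, -, he₁⟩ := exists_of_mapAtom_eq hab₁ hva₁
      rcases treeModel_cases (hn a₂ (hq₂.1 ha₂).1) with ⟨a', -, h'⟩ | ⟨k, t', b', hk, -, hb', h'⟩
      · obtain ⟨u, -, hu⟩ := exists_of_mapAtom_eq h' hva₂
        rw [← hu]
        rfl
      · obtain rfl : m = k := Nat.succ_injective hk
        have htt : t ≠ t' := by
          rintro rfl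
          exact (hq₂.1 ha₂).2 ⟨b', hb', h'⟩
        obtain ⟨e', -, he'⟩ := exists_of_mapAtom_eq h' hva₂
        rw [← he₁]
        exact root_of_incl_eq htt (he₁.trans he'.symm)
    have hsub : ∀ {q v}, v ∈ lvars q ++ Y q → v ∈ lvars q := fun hv =>
      (List.mem_append.1 hv).elim id fun hv => (hY'.1 hv).2.1
    have hvar₁ : ∀ v ∈ lvars q₁, v < varBound S Q := fun v hv => by
      obtain ⟨a, ha, hva⟩ := mem_lvars.1 hv
      exact hlt v (mem_lvars.2 ⟨a, (hq₁.1 ha).1, hva⟩)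
    have hYsub : ∀ v ∈ p.2, v ∈ Y q₁ ++ Y q₂ := fun v hv => by
      obtain ⟨hv1, hv2⟩ := hY v hv
      obtain ⟨a, ha, hva⟩ := mem_lvars.1 hv1
      by_cases hPa : P a
      · exact List.mem_append_left _
          (hY'.2 ⟨hlt v hv1, mem_lvars.2 ⟨a, hq₁.2 ⟨ha, hPa⟩, hva⟩, hv2⟩)
      · exact List.mem_append_right _
          (hY'.2 ⟨hlt v hv1, mem_lvars.2 ⟨a, hq₂.2 ⟨ha, hPa⟩, hva⟩, hv2⟩)
    have hjoin : Joinable (q₁, Y q₁) (q₂, Y q₂) p := by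
      refine ⟨fun v hv hv' => ?_, fun a ha => ?_, hYsub⟩
      · have h1 := hsub hv
        have h2 := hsub hv'
        have h3 := hshare v h1 h2
        exact ⟨hY'.2 ⟨hvar₁ v h1, h1, h3⟩, hY'.2 ⟨hvar₁ v h1, h2, h3⟩⟩
      · by_cases hPa : P a
        · exact List.mem_append_left _ (hq₁.2 ⟨ha, hPa⟩)
        · exact List.mem_append_right _ (hq₂.2 ⟨ha, hPa⟩)
    refine hT.of_rule hR (mem_bagRules.2 (Or.inr (mem_viewRules.2
      (Or.inr ⟨_, hv₁, _, hv₂, p, hp, hjoin, rfl⟩)))) (fun v hv => ?_) fun b hb => ?_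
    · rcases List.mem_append.1 (hYsub v hv) with h1 | h1
      · exact mem_lvars.2 ⟨_, List.mem_cons_self, h1⟩
      · exact mem_lvars.2 ⟨_, List.mem_cons_of_mem _ List.mem_cons_self, h1⟩
    · rcases List.mem_pair.1 hb with rfl | rfl
      exacts [hu₁, hu₂]

/-! ### Completeness -/

theorem isSaturated_of_satisfies {M : Instance} (hM : ∀ r ∈ program S Q, Satisfies M r) :
    IsSaturated S Q {p | seqAtom (nameBound S Q) p ∈ M} := by
  refine ⟨fun B hB a ha => ?_, fun B hB r F B' a ht ha ρ hρ => ?_⟩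
  · obtain ⟨η, -, h⟩ := satisfies_iff.1 (hM _ (mem_program.2 (Or.inr (Or.inl ⟨B, a, hB, ha, rfl⟩))))
      id (by simp)
    exact h _ (List.mem_singleton_self _)
  · obtain ⟨⟨h1, h2, h3, h4⟩, h5, h6, h7⟩ := mem_steps.1 ht
    set w := varBound S Q
    have hlt : ∀ v ∈ lvars r.1, v < w ∧ ρ v < w := fun v hv => by
      obtain ⟨b, hb, hvb⟩ := mem_lvars.1 hv
      refine ⟨(mem_bagAtoms.1 (mem_bagAtoms_of_bagRules h1 (Or.inl hb))).2 v hvb, ?_⟩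
      exact (mem_bagAtoms.1 (hρ b (List.mem_append_left _ hb)).1).2 _ (List.mem_map_of_mem hvb)
    -- Body variables have images below `w`, since those images occur in bag atoms. At other
    -- variables the values are adjusted only so that `L` is among the enumerated tuples.
    set L := (List.range w).map fun v => if ρ v < w then ρ v else v
    have hL : L ∈ tuples (List.range w) w := by
      refine mem_tuples.2 ⟨by simp [L], fun x hx => ?_⟩
      obtain ⟨v, hv, rfl⟩ := List.mem_map.1 hx
      split_ifs with h
      exacts [List.mem_range.2 h, hv]
    have hLρ : ∀ v ∈ lvars r.1, listFun L v = ρ v := fun v hv => by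
      simp [listFun, L, hlt v hv]
    have haL : a.rename (listFun L) = a.rename ρ := rename_congr fun v hv => hLρ v (h7 v hv)
    obtain ⟨η, -, h⟩ := satisfies_iff.1 (hM _ (mem_program.2 (Or.inr (Or.inr (Or.inr
      ⟨_, ht, B, hB, L, hL, rfl⟩))))) id fun b hb => by
        rcases List.mem_append.1 hb with hb | hb
        · obtain ⟨b, hb', rfl⟩ := List.mem_map.1 hb
          replace hb : b ∈ r.1 ++ F := hb'
          have hbL : b.rename (listFun L) = b.rename ρ := rename_congr fun v hv => hLρ v <| by
            rcases List.mem_append.1 hb with hb | hb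
            exacts [mem_lvars.2 ⟨b, hb, hv⟩, h6 v (mem_lvars.2 ⟨b, hb, hv⟩)]
          simp only [hbL]
          exact (hρ b hb).2
        · rw [List.mem_singleton.1 hb]
          exact ha
    have h8 := h _ (List.mem_singleton_self _)
    simp only [haL] at h8
    refine ⟨mem_bagAtoms.2 ⟨?_, fun v hv => ?_⟩, h8⟩
    · rw [rename_pred]
      exact (mem_bagAtoms.1 h4).1
    · obtain ⟨u, hu, rfl⟩ := List.mem_map.1 hv
      exact (hlt u (h7 u hu)).2

theorem isDatalogRule_of_mem_program {r : TGD} (hr : r ∈ program S Q) : IsDatalogRule r := by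
  intro v hv
  change v ∈ vars r.2.toInstance at hv
  change v ∈ vars r.1.toInstance
  rw [mem_vars_toInstance] at hv ⊢
  rcases mem_program.1 hr with ⟨q, hq, rfl⟩ | ⟨B, a, hB, ha, rfl⟩ | ⟨⟨r, F, B, a⟩, ht, rfl⟩ |
    ⟨⟨r, F, B, a⟩, ht, B', hB', L, -, rfl⟩
  · simp [lvars, goalAtom] at hv
  · simp [lvars, seqAtom] at hv
  · obtain ⟨-, -, -, h⟩ := mem_steps.1 ht
    have hv' : v ∈ a.2 := by simpa [stepRule, lvars] using hv
    obtain ⟨b, hb, hvb⟩ := mem_lvars.1 (h v hv')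
    exact mem_lvars.2 ⟨b, List.mem_append_left _ (List.mem_append_left _ hb), hvb⟩
  · simp [bagStepRule, lvars, seqAtom] at hv

theorem isClosed_of_satisfies {M : Instance} (hM : ∀ r ∈ program S Q, Satisfies M r) :
    IsClosed S Q {p | seqAtom (nameBound S Q) p ∈ M} M := by
  intro r F B a ht ha ρ hρ
  have hr := mem_program.2 (Or.inr (Or.inr (Or.inl ⟨_, ht, rfl⟩)))
  obtain ⟨η, h1, h⟩ := satisfies_iff.1 (hM _ hr) ρ fun b hb => by
    rcases List.mem_append.1 hb with hb | hb
    · exact hρ b hb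
    · rw [List.mem_singleton.1 hb]
      exact ha
  have h2 := h a (List.mem_singleton_self _)
  rwa [rename_congr fun v hv => ?_] at h2
  have hv' : v ∈ lvars (stepRule (nameBound S Q) (r, F, B, a)).2 :=
    mem_lvars.2 ⟨a, List.mem_singleton_self _, hv⟩
  exact h1 v (mem_vars_toInstance.1 (isDatalogRule_of_mem_program hr
    (mem_vars_toInstance.2 hv'))) hv'

theorem certain_program_of_certain (hS : ∀ r ∈ S, BetaGuarded r) {D : Instance}
    (h : Certain {D} {r | r ∈ S} {I | ∃ J ∈ Q, FinInstance.toInstance J = I}) :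
    Certain {D} {r | r ∈ program S Q}
      {FinInstance.toInstance [goalAtom (nameBound S Q)]} := by
  intro M hD hM
  set R : Set (FinInstance × Atom) := {p | seqAtom (nameBound S Q) p ∈ M}
  have hR : IsSaturated S Q R := isSaturated_of_satisfies hM
  have hT : IsClosed S Q R M := isClosed_of_satisfies hM
  -- Instances have natural numbers as elements, so the tree is transported along an encoding.
  have hinj : (encode : Elem → ℕ).Injective := encode_injective
  set N : Instance := {x | ∃ n, ∃ y ∈ treeModel S Q R n M, x = mapAtom encode y}
  have hlift : ∀ θ : Var → Var, ∃ θ' : Var → Elem, ∀ a : Atom, a.rename θ ∈ N →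
      (∃ n, mapAtom θ' a ∈ treeModel S Q R n M) ∧ ∀ v ∈ a.2, encode (θ' v) = θ v := by
    intro θ
    obtain ⟨θ', hθ'⟩ := exists_lift hinj θ
    refine ⟨θ', fun a ⟨n, y, hy, hay⟩ => ?_⟩
    obtain ⟨rfl, h2⟩ := hθ' a y hay
    exact ⟨⟨n, hy⟩, h2⟩
  have hND : EntailsSome N {D} := by
    rw [entailsSome_singleton] at hD ⊢
    obtain ⟨θ, hθ⟩ := hD
    refine ⟨fun v => encode (rootElem (θ v)), ?_⟩
    rintro _ ⟨a, ha, rfl⟩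
    refine ⟨0, _, root_mem_treeModel (hθ ⟨a, ha, rfl⟩) 0, ?_⟩
    change _ = mapAtom _ (mapAtom _ (mapAtom _ _))
    rw [mapAtom_mapAtom, mapAtom_mapAtom]
    rfl
  have hNS : ∀ r ∈ S, Satisfies N r := by
    refine fun r hr => satisfies_iff.2 fun θ hθ => ?_
    obtain ⟨g, hg, hgv⟩ := hS r hr
    obtain ⟨θ', hθ'⟩ := hlift θ
    obtain ⟨n, hn⟩ := (hθ' g (hθ g hg)).1
    obtain ⟨η, h1, h2⟩ := treeModel_satisfies hR hT hr
      (fun v hv => hgv (mem_vars_toInstance.2 hv)) hn fun a ha => (hθ' a (hθ a ha)).1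
    refine ⟨fun v => encode (η v), fun v hv _ => ?_, fun a ha => ?_⟩
    · obtain ⟨a, ha, hva⟩ := mem_lvars.1 hv
      simp only [h1 v hv]
      exact (hθ' a (hθ a ha)).2 v hva
    · obtain ⟨m, hm⟩ := h2 a ha
      exact ⟨m, _, hm, (mapAtom_mapAtom _ _ _).symm⟩
  obtain ⟨_, ⟨q, hq, rfl⟩, θ, hθ⟩ := h N hND hNS
  rw [entailsSome_singleton, entails_goal]
  rw [rename_subset_iff] at hθ
  obtain ⟨θ', hθ'⟩ := hlift θ
  choose! f hf using fun a ha => (hθ' a (hθ a ha)).1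
  have hview : (viewAtom (nameBound S Q) (q, [])).rename (fun v => (θ' v).2) ∈ M := by
    -- The query is finite, so its matched atoms have a common depth bound.
    refine viewAtom_mem hR hT (n := strictBound (q.map f))
      (mem_views.2 ⟨⟨q, hq, List.Sublist.refl q⟩, List.nil_sublist _⟩) (fun a ha => ?_) (by simp)
    exact treeModel_mono (lt_strictBound (List.mem_map_of_mem ha)).le (hf a ha)
  obtain ⟨η, -, h⟩ := satisfies_iff.1 (hM _ (mem_program.2 (Or.inl ⟨q, hq, rfl⟩))) id
    (List.forall_mem_singleton.2 hview)
  exact h _ (List.mem_singleton_self _)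

theorem not_mem_auxPreds {a : Atom} (h : a ∈ inputAtoms S Q) : a.pred ∉ auxPreds S Q := fun h' =>
  absurd (name_lt_nameBound h) (mem_auxPreds.1 h').2.not_gt

theorem isDatalogRewriting (hS : ∀ r ∈ S, BetaGuarded r) :
    IsDatalogRewriting {r | r ∈ S} {I | ∃ J ∈ Q, FinInstance.toInstance J = I}
      {p | p ∈ auxPreds S Q} {r | r ∈ program S Q}
      (FinInstance.toInstance [goalAtom (nameBound S Q)]) where
  fresh_tgds := by
    intro r hr
    rw [Set.disjoint_right]
    rintro _ (⟨a, ha, rfl⟩ | ⟨a, ha, rfl⟩)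
    · exact not_mem_auxPreds (mem_inputAtoms.2 (Or.inl ⟨r, hr, Or.inl ha⟩))
    · exact not_mem_auxPreds (mem_inputAtoms.2 (Or.inl ⟨r, hr, Or.inr ha⟩))
  fresh_query := by
    rintro _ ⟨q, hq, rfl⟩
    rw [Set.disjoint_right]
    rintro _ ⟨a, ha, rfl⟩
    exact not_mem_auxPreds (mem_inputAtoms.2 (Or.inr ⟨q, hq, ha⟩))
  finite := List.finite_toSet _
  datalog := fun r hr => isDatalogRule_of_mem_program hr
  goal := by
    refine ⟨(goalAtom (nameBound S Q)).1, mem_auxPreds.2 ⟨Or.inl rfl, le_goalAtom _⟩, ?_⟩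
    ext a
    exact List.mem_singleton
  equiv := fun D hD => ⟨certain_program_of_certain hS, certain_of_certain_program hD⟩

end Model

end DatalogRew

theorem corollary5 :
    ∃ f : List DatalogRew.TGD × List DatalogRew.FinInstance →
        List DatalogRew.Pred × List DatalogRew.TGD × DatalogRew.FinInstance,
      Computable f ∧
      ∀ (S : List DatalogRew.TGD) (Q : List DatalogRew.FinInstance),
        (∀ r ∈ S, DatalogRew.BetaGuarded r) →
        DatalogRew.IsDatalogRewriting
          {r | r ∈ S}
          {I | ∃ J ∈ Q, DatalogRew.FinInstance.toInstance J = I}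
          {p | p ∈ (f (S, Q)).1}
          {r | r ∈ (f (S, Q)).2.1}
          (DatalogRew.FinInstance.toInstance (f (S, Q)).2.2) :=
  ⟨DatalogRew.rewriting, DatalogRew.primrec_rewriting.to_comp, fun _ _ hS =>
    DatalogRew.isDatalogRewriting hS⟩
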